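/- Let $n\ge 2$, let $D\subset\mathbb R^n$ be bounded and open, and let $(\Omega,\mathcal H,\mathbb P)$ be a probability space. Let $q$ be a Gaussian generalized random function on $\mathbb R^n$: each realization $q(\omega)$ is a linear functional on $C_0^\infty(\mathbb R^n;\mathbb R)$; each $\langle q,\phi\rangle$ is a random variable; all finite linear combinations of such variables are (possibly degenerate) Gaussian; and for every compact $A\subset\mathbb R^n$ there are $N\in\mathbb N$ and a random variable $C\ge 0$ with $\mathbb E C^2<\infty$ such that, almost surely, $|\langle q,\phi\rangle|\le C\sum_{|\alpha|\le N}\sup|\partial^\alpha\phi|$ for all $\phi\in C_0^\infty(\mathbb R^n;\mathbb R)$ supported in $A$. Suppose that $q$ is microlocally isotropic of order $-m$ in $D$ with local strength $\mu$, that is: * $\mathbb E q$ is (given by) a smooth function (in particular $\mathbb E q=0$ is allowed); * $\operatorname{supp} q\subset D$ almost surely; * $n-1<m\le n+1$, and the covariance operator $C_q$, $\langle C_q\phi,\psi\rangle=\operatorname{Cov}(\langle q,\phi\rangle,\langle q,\psi\rangle)$, is a classical pseudodifferential operator of order $-m$ with principal symbol $\mu(x)|\xi|^{-m}$, where $\mu\in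 C_0^\infty(\mathbb R^n;\mathbb R)$, $\operatorname{supp}\mu\subset D$ and $\mu\ge 0$. For $k>0$ and $\theta\in\mathbb S^{n-1}$ let $$u_1^\infty(k,\theta,-\theta)=c_n\int_{\mathbb R^n}e^{ik\theta\cdot y}\,q(y)\,e^{ik\theta\cdot y}\,dy=c_n\langle q,e^{2ik\theta\cdot y}\rangle$$ be the single backscattering far-field pattern, where $c_n\in\mathbb C$ is the normalizing constant of the far-field pattern and the pairing is that of a compactly supported distribution with a smooth function. Write $\widehat\mu(\xi)=(2\pi)^{-n/2}\int_{\mathbb R^n}e^{-i\xi\cdot x}\mu(x)\,dx$. Then for each fixed $\tau\ge 0$ and $\theta\in\mathbb S^{n-1}$, almost surely, $$\lim_{K\to\infty}\frac1K\int_K^{2K}k^m\,u_1^\infty(k,\theta,-\theta)\,\overline{u_1^\infty(k+\tau,\theta,-\theta)}\,dk=c_{n,m}\,\widehat\mu(2\tau\theta),\qquad c_{n,m}=|c_n|^2\,2^{-m}(2\pi)^{n/2},$$ the integrals on the left being absolutely convergent for every $K>0$. -/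

import Mathlib

open MeasureTheory ProbabilityTheory Filter Topology Set TopologicalSpace
open scoped Distributions

noncomputable section

/-- The Euclidean space `ℝⁿ`. -/
abbrev Rn (n : ℕ) : Type := EuclideanSpace ℝ (Fin n)

/-- Real test functions `C₀^∞(ℝⁿ; ℝ)`. -/
abbrev RealTest (n : ℕ) : Type := TestFunction (⊤ : Opens (Rn n)) ℝ ⊤

/-- Complex test functions `C₀^∞(ℝⁿ)`. -/
abbrev ComplexTest (n : ℕ) : Type := TestFunction (⊤ : Opens (Rn n)) ℂ ⊤

/-! ### Generalized random functions -/

/-- A generalized random function: every realization `q ω` is a linear functional on real test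
functions, `⟨q, φ⟩` is a random variable for every `φ`, and on every compact set `K` the
realizations are almost surely bounded by a `C^N` norm times a square integrable random
variable. -/
structure IsGeneralizedRandomFunction {n : ℕ} {Ω : Type*} [MeasurableSpace Ω] (P : Measure Ω)
    (q : Ω → RealTest n →ₗ[ℝ] ℝ) : Prop where
  measurable_apply : ∀ φ : RealTest n, Measurable (fun ω => q ω φ)
  bound : ∀ K : Set (Rn n), IsCompact K →
    ∃ (C : Ω → ℝ) (N : ℕ), Measurable C ∧ (∀ ω, 0 ≤ C ω) ∧ MemLp C 2 P ∧
      ∀ᵐ ω ∂P, ∀ φ : RealTest n, tsupport φ ⊆ K →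
        |q ω φ| ≤ C ω * ∑ i ∈ Finset.range (N + 1), ⨆ x, ‖iteratedFDeriv ℝ i φ x‖

/-- A Gaussian generalized random function: all finite linear combinations of the random
variables `⟨q, φ⟩` have a (possibly degenerate) Gaussian law. -/
structure IsGaussianGeneralizedRandomFunction {n : ℕ} {Ω : Type*} [MeasurableSpace Ω]
    (P : Measure Ω) (q : Ω → RealTest n →ₗ[ℝ] ℝ) : Prop
    extends IsGeneralizedRandomFunction P q where
  gaussian : IsGaussianProcess (fun (φ : RealTest n) ω => q ω φ) P

/-! ### Symbols and pseudodifferential operators -/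

/-- The estimates `|∂_x^α ∂_ξ^β a(x, ξ)| ≤ C_{αβ} (1 + |ξ|)^{d - |β|}` for all `x` and
all `ξ ∈ S`. -/
def SymbolEstimates {n : ℕ} (d : ℝ) (S : Set (Rn n)) (a : Rn n → Rn n → ℂ) : Prop :=
  ∀ i j : ℕ, ∃ C : ℝ, ∀ x : Rn n, ∀ ξ ∈ S,
    ‖iteratedFDeriv ℝ i (fun x' => iteratedFDeriv ℝ j (a x') ξ) x‖ ≤
      C * (1 + ‖ξ‖) ^ (d - (j : ℝ))

/-- Classical (polyhomogeneous) symbols of order `d` on `ℝⁿ × ℝⁿ`: smooth functions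
`a ∈ S^d` with an asymptotic expansion `a ∼ ∑_j p_j`, where `p_j` is smooth for `ξ ≠ 0` and
positively homogeneous of degree `d - j` in `ξ`. -/
structure IsClassicalSymbol {n : ℕ} (d : ℝ) (a : Rn n → Rn n → ℂ) : Prop where
  smooth : ContDiff ℝ (⊤ : ℕ∞) (fun z : Rn n × Rn n => a z.1 z.2)
  estimates : SymbolEstimates d univ a
  expansion : ∃ p : ℕ → Rn n → Rn n → ℂ,
    (∀ j, ContDiffOn ℝ (⊤ : ℕ∞) (fun z : Rn n × Rn n => p j z.1 z.2) {z | z.2 ≠ 0}) ∧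
    (∀ j x ξ, ξ ≠ 0 → ∀ t : ℝ, 0 < t →
      p j x (t • ξ) = ((t ^ (d - (j : ℝ)) : ℝ) : ℂ) * p j x ξ) ∧
    ∀ N : ℕ, SymbolEstimates (d - (N : ℝ)) {ξ | 1 ≤ ‖ξ‖}
      (fun x ξ => a x ξ - ∑ j ∈ Finset.range N, p j x ξ)

/-- The function `σ`, homogeneous of degree `d` in `ξ`, is a principal symbol of `a`: the
difference satisfies the estimates of order `d - 1` for `|ξ| ≥ 1`. -/
def HasPrincipalSymbol {n : ℕ} (d : ℝ) (a σ : Rn n → Rn n → ℂ) : Prop :=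
  SymbolEstimates (d - 1) {ξ | 1 ≤ ‖ξ‖} (fun x ξ => a x ξ - σ x ξ)

/-- The operator with symbol `a`:
`(2π)^{-n} ∫ ∫ e^{i (x - y)·ξ} a(x, ξ) φ(y) dy dξ`. -/
def pseudoDiffOp {n : ℕ} (a : Rn n → Rn n → ℂ) (φ : RealTest n) (x : Rn n) : ℂ :=
  (((2 * Real.pi) ^ n : ℝ) : ℂ)⁻¹ *
    ∫ ξ : Rn n, ∫ y : Rn n,
      Complex.exp (Complex.I * ((inner ℝ (x - y) ξ : ℝ) : ℂ)) * a x ξ * ((φ y : ℝ) : ℂ)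

/-- The covariance operator of `q`, `⟨C_q φ, ψ⟩ = Cov(⟨q, φ⟩, ⟨q, ψ⟩)`, is the
pseudodifferential operator with symbol `a`. -/
def HasCovarianceSymbol {n : ℕ} {Ω : Type*} [MeasurableSpace Ω] (P : Measure Ω)
    (q : Ω → RealTest n →ₗ[ℝ] ℝ) (a : Rn n → Rn n → ℂ) : Prop :=
  ∀ φ ψ : RealTest n,
    ((covariance (fun ω => q ω φ) (fun ω => q ω ψ) P : ℝ) : ℂ) =
      ∫ x : Rn n, pseudoDiffOp a φ x * ((ψ x : ℝ) : ℂ)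

/-! ### Microlocally isotropic fields -/

/-- `q` is microlocally isotropic of order `-m` in `D`, with local strength `μ`. -/
structure IsMicrolocallyIsotropic {n : ℕ} {Ω : Type*} [MeasurableSpace Ω] (P : Measure Ω)
    (q : Ω → RealTest n →ₗ[ℝ] ℝ) (D : Set (Rn n)) (m : ℝ) (μ : Rn n → ℝ) : Prop where
  /-- The mean `φ ↦ 𝔼⟨q, φ⟩` is a smooth function. -/
  mean_smooth : ∃ f : Rn n → ℝ, ContDiff ℝ (⊤ : ℕ∞) f ∧
    ∀ φ : RealTest n, ∫ ω, q ω φ ∂P = ∫ x, f x * φ x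
  /-- The realizations are almost surely supported in `D`. -/
  support_subset : ∀ᵐ ω ∂P, Distribution.dsupport (fun φ : RealTest n => q ω φ) ⊆ D
  lt_order : (n : ℝ) - 1 < m
  order_le : m ≤ (n : ℝ) + 1
  strength_smooth : ContDiff ℝ (⊤ : ℕ∞) μ
  strength_compact : HasCompactSupport μ
  strength_support : tsupport μ ⊆ D
  strength_nonneg : ∀ x, 0 ≤ μ x
  /-- The covariance operator is a classical pseudodifferential operator of order `-m` with
  principal symbol `μ(x) |ξ|^{-m}`. -/
  covariance_symbol : ∃ a : Rn n → Rn n → ℂ,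
    IsClassicalSymbol (-m) a ∧
    HasPrincipalSymbol (-m) a (fun x ξ => ((μ x * ‖ξ‖ ^ (-m) : ℝ) : ℂ)) ∧
    HasCovarianceSymbol P q a

/-! ### Single scattering -/

/-- The extension `⟨T, φ⟩ = ⟨T, Re φ⟩ + i ⟨T, Im φ⟩` to complex test functions. -/
def complexPairing {n : ℕ} (T : RealTest n →ₗ[ℝ] ℝ) (φ : ComplexTest n) : ℂ :=
  ((T (TestFunction.postcompCLM Complex.reCLM φ) : ℝ) : ℂ) +
    Complex.I * ((T (TestFunction.postcompCLM Complex.imCLM φ) : ℝ) : ℂ)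

/-- The complex test function `χ f`, for `f` smooth. -/
def cutoffMul {n : ℕ} (χ : RealTest n) (f : Rn n → ℂ) (hf : ContDiff ℝ (⊤ : ℕ∞) f) :
    ComplexTest n where
  toFun y := χ y • f y
  contDiff' := χ.contDiff.smul hf
  hasCompactSupport' := χ.hasCompactSupport.smul_right
  tsupport_subset' := fun _ _ => trivial

/-- The plane wave `e^{i k θ·y}`. -/
def planeWave {n : ℕ} (k : ℝ) (θ : Rn n) (y : Rn n) : ℂ :=
  Complex.exp (Complex.I * (k : ℂ) * ((inner ℝ θ y : ℝ) : ℂ))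

theorem contDiff_planeWave {n : ℕ} (k : ℝ) (θ : Rn n) : ContDiff ℝ (⊤ : ℕ∞) (planeWave k θ) := by
  unfold planeWave
  have h : ContDiff ℝ (⊤ : ℕ∞) (fun y : Rn n => ((inner ℝ θ y : ℝ) : ℂ)) :=
    Complex.ofRealCLM.contDiff.comp (contDiff_const.inner ℝ contDiff_id)
  exact (contDiff_const.mul h).cexp

/-- The far-field pattern of the first term of the Born series, at wavenumber `k`, incident
direction `θ` and observation direction `ϑ`:
`u₁^∞(k, θ, ϑ) = c ∫ e^{-i k ϑ·y} V(y) u₀(y) dy`, with `u₀(y) = e^{i k θ·y}`.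
The integral is the pairing of the compactly supported distribution `V` with a smooth function,
computed as `⟨V, χ e^{-i k ϑ·y} u₀⟩` with `χ ∈ C₀^∞` equal to `1` on an open set containing the
support of `V`; it does not depend on `χ`. -/
def singleScatteringFarField {n : ℕ} (c : ℂ) (V : RealTest n →ₗ[ℝ] ℝ) (χ : RealTest n)
    (k : ℝ) (θ ϑ : Rn n) : ℂ :=
  c * complexPairing V
    (cutoffMul χ (fun y => planeWave k (-ϑ) y * planeWave k θ y)
      ((contDiff_planeWave k (-ϑ)).mul (contDiff_planeWave k θ)))

/-- The unitary Fourier transform `(2π)^{-n/2} ∫ e^{-i ξ·x} f(x) dx`. -/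
def unitaryFourier {n : ℕ} (f : Rn n → ℝ) (ξ : Rn n) : ℂ :=
  (((2 * Real.pi) ^ (-((n : ℝ) / 2)) : ℝ) : ℂ) *
    ∫ x : Rn n, Complex.exp (-(Complex.I * ((inner ℝ ξ x : ℝ) : ℂ))) * ((f x : ℝ) : ℂ)

/-- The constant `c_{n,m} = |c|² 2^{-m} (2π)^{n/2}`, where `c = c_n` is the normalizing constant
of the far-field pattern. -/
def backscatteringConst (c : ℂ) (n : ℕ) (m : ℝ) : ℝ :=
  ‖c‖ ^ 2 * (2 : ℝ) ^ (-m) * (2 * Real.pi) ^ ((n : ℝ) / 2)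

/-- The correlation `k^m u₁^∞(k, θ, -θ) conj(u₁^∞(k + τ, θ, -θ))` of the single backscattering
at two frequencies. -/
def backscatteringCorrelation {n : ℕ} (c : ℂ) (V : RealTest n →ₗ[ℝ] ℝ) (χ : RealTest n) (m τ : ℝ)
    (θ : Rn n) (k : ℝ) : ℂ :=
  ((k ^ m : ℝ) : ℂ) * singleScatteringFarField c V χ k θ (-θ) *
    (starRingEnd ℂ) (singleScatteringFarField c V χ (k + τ) θ (-θ))

end

/-!
The square of the plane wave `e^{ikθ·y}` is the character of frequency `2kθ`, so the far field at
frequency `k + τ` is the pairing of `q` with the wave packet `e^{2ikθ·y} F(y)`, where the shift `τ`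
has been absorbed into the complex amplitude `F = χ e^{2iτθ·y}`. The covariance of two such packets
at frequencies `k` and `l` is an integral of the symbol against translates of rapidly decaying
Fourier transforms. Hence it decays when `|k - l|` grows and, on the diagonal, has the leading term
`|2k|^{-m} ∫ μ F conj(G)`.

By polarization it is enough to average the squares `V_k²` of the real Gaussian process
`V_k = k^{m/2} Re ⟨q, e^{2ikθ·y} F⟩`. For Gaussian variables the covariance of squares is controlled
by the covariance, so the variance of the average of `V²` over an interval tends to zero at a rate
that is summable along the squares of the integers; the averages converge almost surely along this
sequence, and monotonicity of `K ↦ ∫_0^K V_k² dk` fills the gaps.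
-/

/-! ### Fourth moments of Gaussian variables -/

theorem iteratedDeriv_four_exp_quadratic (a v : ℝ) :
    iteratedDeriv 4 (fun t : ℝ => Real.exp (a * t + v * t ^ 2 / 2)) 0 =
      3 * v ^ 2 + 6 * v * a ^ 2 + a ^ 4 := by
  set e : ℝ → ℝ := fun t => Real.exp (a * t + v * t ^ 2 / 2)
  have hw (t : ℝ) : HasDerivAt (fun t => a + v * t) v t := by
    simpa using ((hasDerivAt_id t).const_mul v).const_add a
  have he (t : ℝ) : HasDerivAt e ((a + v * t) * e t) t := by
    have hquad : HasDerivAt (fun t => a * t + v * t ^ 2 / 2) (a + v * t) t :=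
      (((hasDerivAt_id t).const_mul a).add
        ((((hasDerivAt_id t).pow 2).const_mul v).div_const 2)).congr_deriv (by simp; ring)
    exact hquad.exp.congr_deriv (mul_comm _ _)
  have d1 : deriv e = fun t => (a + v * t) * e t := funext fun t => (he t).deriv
  have d2 : deriv (fun t => (a + v * t) * e t) = fun t => (v + (a + v * t) ^ 2) * e t :=
    funext fun t => (((hw t).fun_mul (he t)).congr_deriv (by ring)).deriv
  have d3 : deriv (fun t => (v + (a + v * t) ^ 2) * e t) =
      fun t => (3 * v * (a + v * t) + (a + v * t) ^ 3) * e t :=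
    funext fun t => (((((hw t).fun_pow 2).const_add v).fun_mul (he t)).congr_deriv
      (by norm_num; ring)).deriv
  have d4 : deriv (fun t => (3 * v * (a + v * t) + (a + v * t) ^ 3) * e t) =
      fun t => (3 * v ^ 2 + 6 * v * (a + v * t) ^ 2 + (a + v * t) ^ 4) * e t :=
    funext fun t => (((((hw t).const_mul (3 * v)).fun_add ((hw t).fun_pow 3)).fun_mul
      (he t)).congr_deriv (by norm_num; ring)).deriv
  simp only [iteratedDeriv_succ', iteratedDeriv_zero, d1, d2, d3, d4]
  simp [e]

section Probability

variable {Ω : Type*} [MeasurableSpace Ω] {P : Measure Ω}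

theorem integral_pow_four_of_hasGaussianLaw {X : Ω → ℝ} (h : HasGaussianLaw X P) :
    ∫ ω, X ω ^ 4 ∂P = 3 * (∫ ω, X ω ^ 2 ∂P) ^ 2 - 2 * (∫ ω, X ω ∂P) ^ 4 := by
  have := h.isProbabilityMeasure
  have hvar : Var[X; P] = (∫ ω, X ω ^ 2 ∂P) - (∫ ω, X ω ∂P) ^ 2 := by
    simpa using variance_eq_sub h.memLp_two
  have hmoment := iteratedDeriv_mgf_zero (X := id) (n := 4)
    (μ := gaussianReal (∫ ω, X ω ∂P) Var[X; P].toNNReal) (by simp)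
  rw [mgf_id_gaussianReal, Real.coe_toNNReal _ (variance_nonneg _ _),
    iteratedDeriv_four_exp_quadratic, ← h.map_eq_gaussianReal,
    integral_map h.aemeasurable (by fun_prop)] at hmoment
  simp only [Pi.pow_apply, id] at hmoment
  rw [← hmoment, hvar]
  ring

theorem memLp_sq_of_hasGaussianLaw {X : Ω → ℝ} (h : HasGaussianLaw X P) :
    MemLp (fun ω => X ω ^ 2) 2 P := by
  rw [memLp_two_iff_integrable_sq (h.aemeasurable.pow_const 2).aestronglyMeasurable]
  refine ((h.memLp (p := 4) (by simp)).integrable_norm_pow (p := 4) (by simp)).congr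
    (ae_of_all _ fun ω => ?_)
  simp only [Real.norm_eq_abs, Even.pow_abs (show Even 4 by decide)]
  ring

theorem integral_sq_mul_sq_of_hasGaussianLaw {X Y : Ω → ℝ}
    (h : HasGaussianLaw (fun ω => (X ω, Y ω)) P) :
    ∫ ω, X ω ^ 2 * Y ω ^ 2 ∂P = (∫ ω, X ω ^ 2 ∂P) * (∫ ω, Y ω ^ 2 ∂P) +
      2 * (∫ ω, X ω * Y ω ∂P) ^ 2 - 2 * (∫ ω, X ω ∂P) ^ 2 * (∫ ω, Y ω ∂P) ^ 2 := by
  have hX := h.fst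
  have hY := h.snd
  have int_four {Z : Ω → ℝ} (hZ : HasGaussianLaw Z P) : Integrable (fun ω => Z ω ^ 4) P :=
    (memLp_sq_of_hasGaussianLaw hZ).integrable_sq.congr (ae_of_all _ fun ω => by ring)
  have iXX := hX.memLp_two.integrable_sq
  have iYY := hY.memLp_two.integrable_sq
  have iXY : Integrable (fun ω => X ω * Y ω) P := hX.memLp_two.integrable_mul hY.memLp_two
  have second_add : ∫ ω, (X ω + Y ω) ^ 2 ∂P =
      (∫ ω, X ω ^ 2 ∂P) + 2 * (∫ ω, X ω * Y ω ∂P) + ∫ ω, Y ω ^ 2 ∂P := by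
    rw [← integral_const_mul, ← integral_add iXX (iXY.const_mul 2),
      ← integral_add (iXX.fun_add (iXY.const_mul 2)) iYY]
    exact integral_congr_ae (ae_of_all _ fun ω => by ring)
  have second_sub : ∫ ω, (X ω - Y ω) ^ 2 ∂P =
      (∫ ω, X ω ^ 2 ∂P) - 2 * (∫ ω, X ω * Y ω ∂P) + ∫ ω, Y ω ^ 2 ∂P := by
    rw [← integral_const_mul, ← integral_sub iXX (iXY.const_mul 2),
      ← integral_add (f := fun ω => X ω ^ 2 - 2 * (X ω * Y ω)) (iXX.sub (iXY.const_mul 2)) iYY]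
    exact integral_congr_ae (ae_of_all _ fun ω => by ring)
  have polarization (ω : Ω) : X ω ^ 2 * Y ω ^ 2 =
      (1 / 12) * ((X ω + Y ω) ^ 4 + (X ω - Y ω) ^ 4 - 2 * (X ω ^ 4 + Y ω ^ 4)) := by ring
  simp_rw [polarization]
  rw [integral_const_mul, integral_sub ((int_four h.fun_add).fun_add (int_four h.fun_sub))
      (((int_four hX).fun_add (int_four hY)).const_mul 2), integral_const_mul,
    integral_add (int_four h.fun_add) (int_four h.fun_sub),
    integral_add (int_four hX) (int_four hY),
    integral_pow_four_of_hasGaussianLaw h.fun_add, integral_pow_four_of_hasGaussianLaw h.fun_sub,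
    integral_pow_four_of_hasGaussianLaw hX, integral_pow_four_of_hasGaussianLaw hY, second_add,
    second_sub, integral_add hX.integrable hY.integrable, integral_sub hX.integrable hY.integrable]
  ring

theorem covariance_sq_sq_le_of_hasGaussianLaw {X Y : Ω → ℝ}
    (h : HasGaussianLaw (fun ω => (X ω, Y ω)) P) :
    cov[fun ω => X ω ^ 2, fun ω => Y ω ^ 2; P] ≤ 2 * (∫ ω, X ω * Y ω ∂P) ^ 2 := by
  have := h.isProbabilityMeasure
  rw [covariance_eq_sub (memLp_sq_of_hasGaussianLaw h.fst) (memLp_sq_of_hasGaussianLaw h.snd)]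
  simp only [Pi.mul_apply]
  rw [integral_sq_mul_sq_of_hasGaussianLaw h]
  have : 0 ≤ (∫ ω, X ω ∂P) ^ 2 * (∫ ω, Y ω ∂P) ^ 2 := by positivity
  linarith

/-! ### A law of large numbers for processes with decaying covariance -/

theorem ae_tendsto_sub_integral_of_summable_variance [IsFiniteMeasure P] {X : ℕ → Ω → ℝ}
    (hX : ∀ j, MemLp (X j) 2 P) (hsum : Summable fun j => Var[X j; P]) :
    ∀ᵐ ω ∂P, Tendsto (fun j => X j ω - ∫ ω', X j ω' ∂P) atTop (𝓝 0) := by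
  have hmeas (j : ℕ) : AEMeasurable (fun ω => ‖X j ω - ∫ ω', X j ω' ∂P‖ₑ ^ 2) P :=
    ((hX j).1.sub aestronglyMeasurable_const).enorm.pow_const 2
  have hfinite : ∫⁻ ω, ∑' j, ‖X j ω - ∫ ω', X j ω' ∂P‖ₑ ^ 2 ∂P ≠ ⊤ := by
    rw [lintegral_tsum hmeas]
    convert! hsum.tsum_ofReal_ne_top using 3 with j
    exact (ofReal_variance (hX j)).symm
  filter_upwards [ae_lt_top' (AEMeasurable.tsum hmeas) hfinite] with ω hω
  have hsq := (ENNReal.tendsto_toReal ENNReal.zero_ne_top).comp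
    (ENNReal.tendsto_atTop_zero_of_tsum_ne_top hω.ne)
  rw [tendsto_zero_iff_abs_tendsto_zero]
  simpa [Function.comp_def, Real.sqrt_sq_eq_abs] using hsq.sqrt

section IntegralOfProcess

variable {T : Type*} [MeasurableSpace T] {ν : Measure T} [IsProbabilityMeasure P]
  [IsProbabilityMeasure ν] {X : T → Ω → ℝ}

theorem memLp_uncurry_of_integral_sq_le (hX : StronglyMeasurable fun y : Ω × T => X y.2 y.1)
    {B : ℝ} (h : ∀ᵐ t ∂ν, MemLp (X t) 2 P ∧ ∫ ω, X t ω ^ 2 ∂P ≤ B) :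
    MemLp (fun y : Ω × T => X y.2 y.1) 2 (P.prod ν) := by
  have hsq : StronglyMeasurable fun y : Ω × T => X y.2 y.1 ^ 2 := hX.pow 2
  rw [memLp_two_iff_integrable_sq hX.aestronglyMeasurable,
    integrable_prod_iff' hsq.aestronglyMeasurable]
  refine ⟨h.mono fun t ht => ht.1.integrable_sq,
    Integrable.of_bound (C := B) (hsq.norm.integral_prod_left' (μ := P)).aestronglyMeasurable
      (h.mono fun t ht => ?_)⟩
  have hnonneg : 0 ≤ ∫ ω, X t ω ^ 2 ∂P := integral_nonneg fun ω => sq_nonneg _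
  simpa [abs_of_nonneg hnonneg] using ht.2

variable (hX : MemLp (fun y : Ω × T => X y.2 y.1) 2 (P.prod ν))
include hX

theorem integrable_mul_of_memLp_uncurry :
    Integrable (fun y : Ω × (T × T) => X y.2.1 y.1 * X y.2.2 y.1) (P.prod (ν.prod ν)) :=
  (hX.comp_measurePreserving ((MeasurePreserving.id P).prod measurePreserving_fst)).integrable_mul
    (hX.comp_measurePreserving ((MeasurePreserving.id P).prod measurePreserving_snd))

theorem memLp_integral_of_memLp_uncurry : MemLp (fun ω => ∫ t, X t ω ∂ν) 2 P := by
  rw [memLp_two_iff_integrable_sq hX.1.integral_prod_right']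
  refine (integrable_mul_of_memLp_uncurry hX).integral_prod_left.congr (ae_of_all _ fun ω => ?_)
  simp only [integral_prod_mul (fun t => X t ω) (fun t => X t ω), sq]

theorem covariance_ae_eq_of_memLp_uncurry : ∀ᵐ z ∂(ν.prod ν), cov[X z.1, X z.2; P] =
    (∫ ω, X z.1 ω * X z.2 ω ∂P) - (∫ ω, X z.1 ω ∂P) * ∫ ω, X z.2 ω ∂P := by
  have hmem : ∀ᵐ t ∂ν, MemLp (X t) 2 P := by
    filter_upwards [hX.integrable_sq.prod_left_ae, hX.1.prodMk_right] with t ht hmeas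
    exact (memLp_two_iff_integrable_sq hmeas).2 ht
  filter_upwards [Measure.quasiMeasurePreserving_fst.ae hmem,
    Measure.quasiMeasurePreserving_snd.ae hmem] with z h1 h2
  exact covariance_eq_sub h1 h2

theorem integrable_covariance_of_memLp_uncurry :
    Integrable (fun z : T × T => cov[X z.1, X z.2; P]) (ν.prod ν) := by
  have hmean := (hX.integrable one_le_two).integral_prod_right
  exact ((integrable_mul_of_memLp_uncurry hX).integral_prod_right.sub (hmean.mul_prod hmean)).congr
    ((covariance_ae_eq_of_memLp_uncurry hX).mono fun _ h => h.symm)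

theorem variance_integral_eq_integral_covariance :
    Var[fun ω => ∫ t, X t ω ∂ν; P] = ∫ z, cov[X z.1, X z.2; P] ∂(ν.prod ν) := by
  have hmul := integrable_mul_of_memLp_uncurry hX
  have hX1 := hX.integrable one_le_two
  have hmean := hX1.integral_prod_right
  rw [variance_eq_sub (memLp_integral_of_memLp_uncurry hX),
    integral_congr_ae (covariance_ae_eq_of_memLp_uncurry hX),
    integral_sub hmul.integral_prod_right (hmean.mul_prod hmean),
    integral_prod_mul (fun t => ∫ ω, X t ω ∂P) (fun t => ∫ ω, X t ω ∂P),
    integral_integral_swap (f := fun ω t => X t ω) hX1, ← sq,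
    ← integral_integral_swap (f := fun ω (z : T × T) => X z.1 ω * X z.2 ω) hmul]
  congr 1
  refine integral_congr_ae (ae_of_all _ fun ω => ?_)
  simp only [Pi.pow_apply, sq, integral_prod_mul (fun t => X t ω) (fun t => X t ω)]

end IntegralOfProcess

theorem integrable_inv_one_add_mul_sub_sq (T : ℝ) :
    Integrable (fun z : ℝ × ℝ => (1 + (T * z.1 - T * z.2) ^ 2)⁻¹)
      ((volume.restrict (Ioc (0 : ℝ) 1)).prod (volume.restrict (Ioc (0 : ℝ) 1))) := by
  refine Integrable.of_bound (C := 1) (by fun_prop) (ae_of_all _ fun z => ?_)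
  rw [Real.norm_of_nonneg (by positivity)]
  exact inv_le_one_of_one_le₀ (le_add_of_nonneg_right (sq_nonneg _))

theorem integral_inv_one_add_mul_sub_sq_le {T : ℝ} (hT : 0 < T) :
    ∫ z, (1 + (T * z.1 - T * z.2) ^ 2)⁻¹
      ∂((volume.restrict (Ioc (0 : ℝ) 1)).prod (volume.restrict (Ioc (0 : ℝ) 1))) ≤
      Real.pi / T := by
  have hint := integrable_inv_one_add_mul_sub_sq T
  have inner_le (x : ℝ) : ∫ y in Ioc (0 : ℝ) 1, (1 + (T * x - T * y) ^ 2)⁻¹ ≤ Real.pi / T := by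
    have hx : Integrable fun y : ℝ => (1 + (T * x - T * y) ^ 2)⁻¹ :=
      (integrable_inv_one_add_sq.comp_sub_left (T * x)).comp_mul_left' hT.ne'
    calc ∫ y in Ioc (0 : ℝ) 1, (1 + (T * x - T * y) ^ 2)⁻¹
        ≤ ∫ y, (1 + (T * x - T * y) ^ 2)⁻¹ :=
          setIntegral_le_integral hx (ae_of_all _ fun y => by positivity)
      _ = Real.pi / T := by
          rw [Measure.integral_comp_mul_left (fun y => (1 + (T * x - y) ^ 2)⁻¹) T,
            integral_sub_left_eq_self (fun y : ℝ => (1 + y ^ 2)⁻¹) volume,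
            integral_univ_inv_one_add_sq, abs_of_pos (inv_pos.2 hT), smul_eq_mul, inv_mul_eq_div]
  rw [integral_prod _ hint]
  refine (integral_mono hint.integral_prod_left (integrable_const _) inner_le).trans_eq ?_
  simp

theorem tendsto_integral_comp_mul_of_tendsto {g : ℝ → ℝ} {M L : ℝ} (hg : Measurable g)
    (hM : ∀ k, 0 ≤ k → |g k| ≤ M) (hL : Tendsto g atTop (𝓝 L)) :
    Tendsto (fun T : ℝ => ∫ s in Ioc (0 : ℝ) 1, g (T * s)) atTop (𝓝 L) := by
  have hlim : Tendsto (fun T : ℝ => ∫ s in Ioc (0 : ℝ) 1, g (T * s)) atTop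
      (𝓝 (∫ _ in Ioc (0 : ℝ) 1, L)) := by
    refine tendsto_integral_filter_of_dominated_convergence (fun _ => M)
      (Eventually.of_forall fun T => (hg.comp (measurable_const_mul T)).aestronglyMeasurable) ?_
      (integrable_const M) ?_
    · filter_upwards [eventually_ge_atTop 0] with T hT
      filter_upwards [ae_restrict_mem measurableSet_Ioc] with s hs
      exact hM _ (mul_nonneg hT hs.1.le)
    · filter_upwards [ae_restrict_mem measurableSet_Ioc] with s hs
      exact hL.comp (tendsto_id.atTop_mul_const hs.1)
  simpa using hlim

theorem tendsto_div_of_monotone_of_tendsto_sq {F : ℝ → ℝ} {l : ℝ} (hF : Monotone F)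
    (h : Tendsto (fun j : ℕ => F (((j : ℝ) + 1) ^ 2) / ((j : ℝ) + 1) ^ 2) atTop (𝓝 l)) :
    Tendsto (fun T => F T / T) atTop (𝓝 l) := by
  have hnat : Tendsto (fun n : ℕ => F n / n) atTop (𝓝 l) := by
    refine tendsto_div_of_monotone_of_exists_subseq_tendsto_div (fun n : ℕ => F n) l
      (fun a b hab => hF (by exact_mod_cast hab)) fun a ha => ⟨fun n => (n + 1) ^ 2, ?_, ?_, ?_⟩
    · have hratio : Tendsto (fun n : ℕ => (1 + 1 / ((n : ℝ) + 1)) ^ 2) atTop (𝓝 ((1 + 0) ^ 2)) :=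
        (tendsto_one_div_add_atTop_nhds_zero_nat.const_add 1).pow 2
      filter_upwards [hratio.eventually (gt_mem_nhds (by simpa using ha))] with n hn
      push_cast
      refine le_of_eq_of_le ?_ (mul_le_mul_of_nonneg_right hn.le (sq_nonneg ((n : ℝ) + 1)))
      field_simp
    · exact tendsto_atTop_mono (fun n => by simp only [id]; nlinarith) tendsto_id
    · simpa using h
  have hfloor : Tendsto (fun T : ℝ => F ⌊T⌋₊ / ⌊T⌋₊ * (⌊T⌋₊ / T)) atTop (𝓝 (l * 1)) :=
    (hnat.comp tendsto_nat_floor_atTop).mul (tendsto_nat_floor_div_atTop (R := ℝ))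
  have hceil : Tendsto (fun T : ℝ => F ⌈T⌉₊ / ⌈T⌉₊ * (⌈T⌉₊ / T)) atTop (𝓝 (l * 1)) :=
    (hnat.comp tendsto_nat_ceil_atTop).mul (tendsto_nat_ceil_div_atTop (R := ℝ))
  rw [mul_one] at hfloor hceil
  refine tendsto_of_tendsto_of_tendsto_of_le_of_le' hfloor hceil ?_ ?_
  · filter_upwards [eventually_ge_atTop 1] with T hT
    have : (0 : ℝ) < ⌊T⌋₊ := by exact_mod_cast Nat.floor_pos.2 hT
    rw [div_mul_div_cancel₀ this.ne']
    exact div_le_div_of_nonneg_right (hF (Nat.floor_le (by linarith))) (by linarith)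
  · filter_upwards [eventually_ge_atTop 1] with T hT
    have : (0 : ℝ) < ⌈T⌉₊ := by exact_mod_cast Nat.ceil_pos.2 (by linarith)
    rw [div_mul_div_cancel₀ this.ne']
    exact div_le_div_of_nonneg_right (hF (Nat.le_ceil _)) (by linarith)

theorem tendsto_inv_mul_integral_two_mul {f : ℝ → ℝ} {L : ℝ} (hf : Continuous f)
    (h : Tendsto (fun T : ℝ => (∫ k in (0 : ℝ)..T, f k) / T) atTop (𝓝 L)) :
    Tendsto (fun K : ℝ => K⁻¹ * ∫ k in K..(2 * K), f k) atTop (𝓝 L) := by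
  have hdouble : Tendsto (fun K : ℝ => 2 * K) atTop atTop :=
    tendsto_id.const_mul_atTop two_pos
  have hlim := ((h.comp hdouble).const_mul 2).sub h
  rw [show 2 * L - L = L by ring] at hlim
  refine hlim.congr fun K => ?_
  rw [← intervalIntegral.integral_interval_sub_left (hf.intervalIntegrable 0 (2 * K))
    (hf.intervalIntegrable 0 K), Function.comp_apply, ← mul_div_assoc,
    mul_div_mul_left _ _ two_ne_zero, inv_mul_eq_div, sub_div]

theorem isProbabilityMeasure_restrict_Ioc_zero_one :
    IsProbabilityMeasure (volume.restrict (Ioc (0 : ℝ) 1)) :=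
  ⟨by simp⟩

section ContinuousProcess

variable [IsProbabilityMeasure P] {X : ℝ → Ω → ℝ} (hmeas : ∀ k, Measurable (X k))
  (hcont : ∀ ω, Continuous fun k => X k ω)
include hmeas hcont

theorem stronglyMeasurable_uncurry_swap_of_continuous :
    StronglyMeasurable fun y : Ω × ℝ => X y.2 y.1 :=
  (stronglyMeasurable_uncurry_of_continuous_of_stronglyMeasurable (u := X) hcont
    fun k => (hmeas k).stronglyMeasurable).comp_measurable measurable_swap

variable (hmem : ∀ k, MemLp (X k) 2 P) {B M : ℝ}
  (hcov : ∀ k, 0 ≤ k → ∀ l, 0 ≤ l → cov[X k, X l; P] ≤ B * (1 + (k - l) ^ 2)⁻¹)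
  (hmean : ∀ k, 0 ≤ k → |∫ ω, X k ω ∂P| ≤ M)
include hmem hcov hmean

theorem memLp_uncurry_comp_mul {T : ℝ} (hT : 0 ≤ T) :
    MemLp (fun y : Ω × ℝ => X (T * y.2) y.1) 2 (P.prod (volume.restrict (Ioc 0 1))) := by
  have := isProbabilityMeasure_restrict_Ioc_zero_one
  refine memLp_uncurry_of_integral_sq_le (X := fun s => X (T * s)) (B := B + M ^ 2)
    ((stronglyMeasurable_uncurry_swap_of_continuous hmeas hcont).comp_measurable
      (g := fun y : Ω × ℝ => (y.1, T * y.2)) (by fun_prop)) ?_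
  filter_upwards [ae_restrict_mem measurableSet_Ioc] with s hs
  have hTs : 0 ≤ T * s := mul_nonneg hT hs.1.le
  have hvar := hcov _ hTs _ hTs
  rw [covariance_self (hmeas _).aemeasurable, variance_eq_sub (hmem _)] at hvar
  have hsq := sq_le_sq' (neg_le_of_abs_le (hmean _ hTs)) (le_of_abs_le (hmean _ hTs))
  refine ⟨hmem _, ?_⟩
  simp only [Pi.pow_apply, sub_self, ne_eq, OfNat.ofNat_ne_zero, not_false_eq_true, zero_pow,
    add_zero, inv_one, mul_one] at hvar
  linarith

theorem variance_average_le {T : ℝ} (hT : 0 < T) :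
    Var[fun ω => ∫ s in Ioc (0 : ℝ) 1, X (T * s) ω; P] ≤ B * (Real.pi / T) := by
  have := isProbabilityMeasure_restrict_Ioc_zero_one
  have hB : 0 ≤ B := by
    have hvar := hcov 0 le_rfl 0 le_rfl
    rw [covariance_self (hmeas 0).aemeasurable] at hvar
    simpa using (variance_nonneg (X 0) P).trans hvar
  have hmemX := memLp_uncurry_comp_mul hmeas hcont hmem hcov hmean hT.le
  rw [variance_integral_eq_integral_covariance (X := fun s => X (T * s)) hmemX]
  calc _ ≤ ∫ z, B * (1 + (T * z.1 - T * z.2) ^ 2)⁻¹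
        ∂((volume.restrict (Ioc (0 : ℝ) 1)).prod (volume.restrict (Ioc (0 : ℝ) 1))) := by
        refine integral_mono_ae
          (integrable_covariance_of_memLp_uncurry (X := fun s => X (T * s)) hmemX)
          ((integrable_inv_one_add_mul_sub_sq T).const_mul B) ?_
        rw [Measure.prod_restrict]
        filter_upwards [ae_restrict_mem (measurableSet_Ioc.prod measurableSet_Ioc)] with z hz
        exact hcov _ (mul_nonneg hT.le hz.1.1.le) _ (mul_nonneg hT.le hz.2.1.le)
    _ ≤ B * (Real.pi / T) := by
        rw [integral_const_mul]
        exact mul_le_mul_of_nonneg_left (integral_inv_one_add_mul_sub_sq_le hT) hB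

theorem ae_tendsto_average_sq_sub_mean :
    ∀ᵐ ω ∂P, Tendsto (fun j : ℕ => (∫ s in Ioc (0 : ℝ) 1, X (((j : ℝ) + 1) ^ 2 * s) ω) -
      ∫ s in Ioc (0 : ℝ) 1, ∫ ω', X (((j : ℝ) + 1) ^ 2 * s) ω' ∂P) atTop (𝓝 0) := by
  have := isProbabilityMeasure_restrict_Ioc_zero_one
  have hmemY (j : ℕ) :=
    memLp_uncurry_comp_mul hmeas hcont hmem hcov hmean (sq_nonneg ((j : ℝ) + 1))
  have hsum : Summable fun j : ℕ =>
      Var[fun ω => ∫ s in Ioc (0 : ℝ) 1, X (((j : ℝ) + 1) ^ 2 * s) ω; P] := by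
    refine Summable.of_nonneg_of_le (fun j => variance_nonneg _ _)
      (fun j => variance_average_le hmeas hcont hmem hcov hmean (by positivity)) ?_
    have := (summable_nat_add_iff 1).2 (Real.summable_nat_pow_inv.2 one_lt_two)
    simpa [div_eq_mul_inv] using (this.mul_left Real.pi).mul_left B
  filter_upwards [ae_tendsto_sub_integral_of_summable_variance
    (fun j => memLp_integral_of_memLp_uncurry (hmemY j)) hsum] with ω hω
  refine hω.congr fun j => ?_
  rw [integral_integral_swap ((hmemY j).integrable one_le_two)]

theorem ae_tendsto_average_of_covariance_le {L : ℝ} (hnonneg : ∀ k ω, 0 ≤ X k ω)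
    (hL : Tendsto (fun k => ∫ ω, X k ω ∂P) atTop (𝓝 L)) :
    ∀ᵐ ω ∂P, Tendsto (fun T : ℝ => (∫ k in (0 : ℝ)..T, X k ω) / T) atTop (𝓝 L) := by
  have hsquares : Tendsto (fun j : ℕ => ((j : ℝ) + 1) ^ 2) atTop atTop :=
    (tendsto_pow_atTop two_ne_zero).comp
      (tendsto_atTop_add_const_right _ 1 tendsto_natCast_atTop_atTop)
  have hmeanlim := (tendsto_integral_comp_mul_of_tendsto
    ((stronglyMeasurable_uncurry_swap_of_continuous hmeas hcont).integral_prod_left'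
      (μ := P)).measurable hmean hL).comp hsquares
  filter_upwards [ae_tendsto_average_sq_sub_mean hmeas hcont hmem hcov hmean] with ω hω
  have hint (a b : ℝ) : IntervalIntegrable (fun k => X k ω) volume a b :=
    (hcont ω).intervalIntegrable a b
  have hmono : Monotone fun T : ℝ => ∫ k in (0 : ℝ)..T, X k ω := by
    intro a b hab
    have := intervalIntegral.integral_nonneg (μ := volume) hab fun k _ => hnonneg k ω
    rw [← intervalIntegral.integral_interval_sub_left (hint 0 b) (hint 0 a)] at this
    exact sub_nonneg.1 this
  refine tendsto_div_of_monotone_of_tendsto_sq hmono ?_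
  have hlim := hω.add hmeanlim
  rw [zero_add] at hlim
  refine hlim.congr fun j => ?_
  rw [Function.comp_apply, sub_add_cancel, ← intervalIntegral.integral_of_le zero_le_one,
    intervalIntegral.integral_comp_mul_left (fun k => X k ω) (by positivity), mul_zero, mul_one,
    smul_eq_mul, inv_mul_eq_div]

end ContinuousProcess

theorem exists_continuous_modification {X : ℝ → Ω → ℝ} (hmeas : ∀ k, Measurable (X k))
    (hcont : ∀ᵐ ω ∂P, Continuous fun k => X k ω) :
    ∃ Y : ℝ → Ω → ℝ, (∀ k, Measurable (Y k)) ∧ (∀ ω, Continuous fun k => Y k ω) ∧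
      ∀ᵐ ω ∂P, ∀ k, X k ω = Y k ω := by
  set s := toMeasurable P {ω | ¬ Continuous fun k => X k ω}
  have hs : ∀ᵐ ω ∂P, ω ∈ sᶜ := by
    rw [ae_iff]
    simp only [mem_compl_iff, not_not]
    exact (measure_toMeasurable _).trans hcont
  refine ⟨fun k => sᶜ.indicator (X k),
    fun k => (hmeas k).indicator (measurableSet_toMeasurable _ _).compl, fun ω => ?_,
    hs.mono fun ω hω k => (indicator_of_mem hω _).symm⟩
  by_cases hω : ω ∈ sᶜ
  · simp only [indicator_of_mem hω]
    by_contra hdiscont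
    exact hω (subset_toMeasurable _ _ hdiscont)
  · simp only [indicator_of_notMem hω]
    exact continuous_const

theorem ae_tendsto_average_sq_of_isGaussianProcess {V : ℝ → Ω → ℝ} (hG : IsGaussianProcess V P)
    (hmeas : ∀ k, Measurable (V k)) (hcont : ∀ᵐ ω ∂P, Continuous fun k => V k ω) {C L : ℝ}
    (hC : ∀ k, 0 ≤ k → ∀ l, 0 ≤ l → |∫ ω, V k ω * V l ω ∂P| ≤ C / (1 + |k - l|))
    (hL : Tendsto (fun k => ∫ ω, V k ω ^ 2 ∂P) atTop (𝓝 L)) :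
    ∀ᵐ ω ∂P, Tendsto (fun K : ℝ => K⁻¹ * ∫ k in K..(2 * K), V k ω ^ 2) atTop (𝓝 L) := by
  have := hG.isProbabilityMeasure
  obtain ⟨Y, hYmeas, hYcont, hVY⟩ := exists_continuous_modification hmeas hcont
  replace hG : IsGaussianProcess Y P := hG.congr fun k => hVY.mono fun ω hω => hω k
  have hsecond (k l : ℝ) : ∫ ω, V k ω * V l ω ∂P = ∫ ω, Y k ω * Y l ω ∂P :=
    integral_congr_ae (hVY.mono fun ω hω => by simp only [hω])
  simp only [sq, hsecond] at hC hL
  have hcov (k : ℝ) (hk : 0 ≤ k) (l : ℝ) (hl : 0 ≤ l) :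
      cov[fun ω => Y k ω ^ 2, fun ω => Y l ω ^ 2; P] ≤ 2 * C ^ 2 * (1 + (k - l) ^ 2)⁻¹ := by
    have hsq : (1 + (k - l) ^ 2) ≤ (1 + |k - l|) ^ 2 := by
      nlinarith [abs_nonneg (k - l), sq_abs (k - l)]
    calc _ ≤ 2 * (∫ ω, Y k ω * Y l ω ∂P) ^ 2 :=
          covariance_sq_sq_le_of_hasGaussianLaw hG.hasGaussianLaw_prodMk
      _ ≤ 2 * (C / (1 + |k - l|)) ^ 2 := by
          gcongr 2 * ?_
          exact sq_le_sq.2 ((hC k hk l hl).trans (le_abs_self _))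
      _ ≤ 2 * C ^ 2 * (1 + (k - l) ^ 2)⁻¹ := by
          rw [div_pow, div_eq_mul_inv, ← mul_assoc]
          gcongr
  have haverage := ae_tendsto_average_of_covariance_le (X := fun k ω => Y k ω ^ 2) (M := C)
    (fun k => (hYmeas k).pow_const 2) (fun ω => (hYcont ω).pow 2)
    (fun k => memLp_sq_of_hasGaussianLaw (hG.hasGaussianLaw_eval k)) hcov
    (fun k hk => by simpa [sq] using hC k hk k hk) (fun _ _ => sq_nonneg _)
    (by simpa only [sq] using hL)
  filter_upwards [haverage, hVY] with ω hω hω'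
  simpa only [hω', Pi.pow_apply] using tendsto_inv_mul_integral_two_mul ((hYcont ω).pow 2) hω

end Probability

open scoped FourierTransform SchwartzMap

noncomputable section

/-! ### Fourier transforms of test functions -/

section Decay

variable {E F : Type*} [NormedAddCommGroup E] [NormedAddCommGroup F]

theorem one_add_norm_le_mul (x y : E) : 1 + ‖x‖ ≤ (1 + ‖y‖) * (1 + ‖x + y‖) := by
  have htriangle : ‖x‖ ≤ ‖x + y‖ + ‖y‖ := by simpa using norm_sub_le (x + y) y
  linarith [mul_nonneg (norm_nonneg y) (norm_nonneg (x + y))]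

theorem one_add_norm_add_rpow_le (x y : E) (s : ℝ) :
    (1 + ‖x + y‖) ^ s ≤ (1 + ‖y‖) ^ |s| * (1 + ‖x‖) ^ s := by
  rcases le_total 0 s with hs | hs
  · rw [abs_of_nonneg hs, ← Real.mul_rpow (by positivity) (by positivity)]
    refine Real.rpow_le_rpow (by positivity) ?_ hs
    simpa using one_add_norm_le_mul (x + y) (-y)
  · rw [abs_of_nonpos hs, Real.rpow_neg (by positivity), ← div_eq_inv_mul,
      le_div_iff₀ (by positivity), ← Real.mul_rpow (by positivity) (by positivity)]
    exact Real.rpow_le_rpow_of_nonpos (by positivity)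
      ((one_add_norm_le_mul x y).trans_eq (mul_comm _ _)) hs

theorem one_add_norm_smul_rpow_le [NormedSpace ℝ E] {c : ℝ} (hc : 1 ≤ c) (x : E) (s : ℝ) :
    (1 + ‖c • x‖) ^ s ≤ c ^ |s| * (1 + ‖x‖) ^ s := by
  rw [norm_smul, Real.norm_of_nonneg (zero_le_one.trans hc)]
  rcases le_total 0 s with hs | hs
  · rw [abs_of_nonneg hs, ← Real.mul_rpow (by positivity) (by positivity)]
    exact Real.rpow_le_rpow (by positivity) (by linarith) hs
  · calc (1 + c * ‖x‖) ^ s ≤ (1 + ‖x‖) ^ s :=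
          Real.rpow_le_rpow_of_nonpos (by positivity)
            (by linarith [le_mul_of_one_le_left (norm_nonneg x) hc]) hs
      _ ≤ c ^ |s| * (1 + ‖x‖) ^ s :=
          le_mul_of_one_le_left (by positivity) (Real.one_le_rpow hc (abs_nonneg s))

theorem continuous_one_add_norm_rpow (s : ℝ) : Continuous fun x : E => (1 + ‖x‖) ^ s :=
  (continuous_const.add continuous_norm).rpow_const fun x =>
    Or.inl (by positivity : 0 < 1 + ‖x‖).ne'

variable [NormedSpace ℝ E] [NormedSpace ℝ F]

theorem exists_norm_schwartz_le_one_add_norm_rpow (f : 𝓢(E, F)) (p : ℝ) :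
    ∃ C : ℝ, 0 ≤ C ∧ ∀ x, ‖f x‖ ≤ C * (1 + ‖x‖) ^ (-p) := by
  obtain ⟨N, hN⟩ := exists_nat_ge p
  refine ⟨2 ^ N * ((Finset.Iic (N, 0)).sup fun i => SchwartzMap.seminorm ℝ i.1 i.2) f,
    by positivity, fun x => ?_⟩
  have hpow := SchwartzMap.one_add_le_sup_seminorm_apply (𝕜 := ℝ) (m := (N, 0)) le_rfl le_rfl f x
  rw [norm_iteratedFDeriv_zero] at hpow
  rw [Real.rpow_neg (by positivity), ← div_eq_mul_inv, le_div_iff₀ (by positivity), mul_comm]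
  refine le_trans (mul_le_mul_of_nonneg_right ?_ (norm_nonneg _)) hpow
  rw [← Real.rpow_natCast]
  exact Real.rpow_le_rpow_of_exponent_le (by linarith [norm_nonneg x]) hN

theorem integrable_one_add_norm_rpow_mul_norm_schwartz [FiniteDimensional ℝ E]
    [MeasurableSpace E] [BorelSpace E] (ν : Measure E) [ν.IsAddHaarMeasure] (f : 𝓢(E, F))
    (p : ℝ) : Integrable (fun x => (1 + ‖x‖) ^ p * ‖f x‖) ν := by
  set r : ℝ := Module.finrank ℝ E + 1
  obtain ⟨C, -, hC⟩ := exists_norm_schwartz_le_one_add_norm_rpow f (p + r)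
  have hmajorant : Integrable (fun x : E => C * (1 + ‖x‖) ^ (-r)) ν :=
    (integrable_one_add_norm (by simp [r])).const_mul C
  refine hmajorant.mono' ((continuous_one_add_norm_rpow p).mul
    f.continuous.norm).aestronglyMeasurable (ae_of_all _ fun x => ?_)
  rw [Real.norm_of_nonneg (by positivity)]
  calc (1 + ‖x‖) ^ p * ‖f x‖
      ≤ (1 + ‖x‖) ^ p * (C * (1 + ‖x‖) ^ (-(p + r))) := by gcongr; exact hC x
    _ = C * (1 + ‖x‖) ^ (-r) := by
        rw [mul_left_comm, ← Real.rpow_add (by positivity)]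
        ring_nf

end Decay

section Fourier

variable {E F : Type*} [NormedAddCommGroup E] [InnerProductSpace ℝ E] [MeasurableSpace E]
  [BorelSpace E] [FiniteDimensional ℝ E] [NormedAddCommGroup F] [NormedSpace ℂ F]

theorem norm_fourierInv_le_integral_norm (f : E → F) (ξ : E) : ‖𝓕⁻ f ξ‖ ≤ ∫ x, ‖f x‖ := by
  rw [Real.fourierInv_eq]
  refine (norm_integral_le_integral_norm _).trans_eq ?_
  simp only [Circle.norm_smul]

theorem one_add_norm_mul_norm_fourierInv_le {f : E → F} (hf : ContDiff ℝ 1 f)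
    (hsupp : HasCompactSupport f) (ξ : E) :
    (1 + ‖ξ‖) * ‖𝓕⁻ f ξ‖ ≤ (∫ x, ‖f x‖) + ∫ x, ‖fderiv ℝ f x‖ := by
  have hint : Integrable f := hf.continuous.integrable_of_hasCompactSupport hsupp
  have hint' : Integrable (fderiv ℝ f) :=
    (hf.continuous_fderiv one_ne_zero).integrable_of_hasCompactSupport (hsupp.fderiv ℝ)
  have hderiv : 2 * Real.pi * ‖ξ‖ * ‖𝓕⁻ f ξ‖ ≤ ∫ x, ‖fderiv ℝ f x‖ := by
    have h := norm_fourierInv_le_integral_norm (fderiv ℝ f) ξ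
    rwa [Real.fourierInv_eq_fourier_neg, Real.fourier_fderiv hint
      (hf.differentiable one_ne_zero) hint', VectorFourier.norm_fourierSMulRight, neg_apply,
      norm_neg, innerSL_apply_norm, norm_neg, ← Real.fourierInv_eq_fourier_neg] at h
  have hpi : ‖ξ‖ * ‖𝓕⁻ f ξ‖ ≤ 2 * Real.pi * ‖ξ‖ * ‖𝓕⁻ f ξ‖ := by
    gcongr
    exact le_mul_of_one_le_left (norm_nonneg ξ) (by linarith [Real.pi_gt_three])
  linarith [norm_fourierInv_le_integral_norm f ξ]

end Fourier

/-! ### Modulated test functions -/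

section TestFunctions

variable {n : ℕ}

/-- The real part of a complex test function, as a linear map. -/
def ComplexTest.re : ComplexTest n →L[ℝ] RealTest n :=
  TestFunction.postcompCLM Complex.reCLM

/-- The complex conjugate of a test function, as a real-linear map. -/
def ComplexTest.conj : ComplexTest n →L[ℝ] ComplexTest n :=
  TestFunction.postcompCLM (Complex.conjCLE : ℂ →L[ℝ] ℂ)

/-- The inclusion of real test functions into complex test functions, as a linear map. -/
def RealTest.toComplex : RealTest n →L[ℝ] ComplexTest n :=
  TestFunction.postcompCLM Complex.ofRealCLM

theorem contDiff_fourierChar_inner :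
    ContDiff ℝ (⊤ : ℕ∞) fun z : Rn n × Rn n => (Real.fourierChar (inner ℝ z.2 z.1) : ℂ) := by
  simp only [Real.fourierChar_apply]
  exact ((Complex.ofRealCLM.contDiff.comp
    (contDiff_const.mul (contDiff_snd.inner ℝ contDiff_fst))).mul contDiff_const).cexp

/-- Modulation of a test function by the character of frequency `ζ`, that is
`x ↦ e^{2πi x·ζ} F(x)`: the factor `2π` is that of Mathlib's Fourier transform, so that modulation
becomes a translation by `ζ` on the Fourier side. -/
def ComplexTest.modulate (ζ : Rn n) : ComplexTest n →ₗ[ℂ] ComplexTest n where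
  toFun F :=
    { toFun := fun x => Real.fourierChar (inner ℝ x ζ) • F x
      contDiff' := (contDiff_fourierChar_inner.comp (contDiff_const.prodMk contDiff_id)).mul
        F.contDiff
      hasCompactSupport' := F.hasCompactSupport.smul_left
      tsupport_subset' := fun _ _ => trivial }
  map_add' F G := by ext x; exact smul_add _ (F x) (G x)
  map_smul' c F := by ext x; exact smul_comm _ c (F x)

open ComplexTest RealTest

@[simp]
theorem ComplexTest.re_apply (F : ComplexTest n) (x : Rn n) : re F x = (F x).re := rfl

@[simp]
theorem ComplexTest.conj_apply (F : ComplexTest n) (x : Rn n) :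
    ComplexTest.conj F x = starRingEnd ℂ (F x) := rfl

@[simp]
theorem RealTest.toComplex_apply (φ : RealTest n) (x : Rn n) : toComplex φ x = (φ x : ℂ) := rfl

@[simp]
theorem ComplexTest.modulate_apply (ζ : Rn n) (F : ComplexTest n) (x : Rn n) :
    modulate ζ F x = Real.fourierChar (inner ℝ x ζ) • F x := rfl

theorem ComplexTest.integrable (F : ComplexTest n) : Integrable F :=
  F.contDiff.continuous.integrable_of_hasCompactSupport F.hasCompactSupport

theorem ComplexTest.modulate_modulate (ζ ζ' : Rn n) (F : ComplexTest n) :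
    modulate ζ (modulate ζ' F) = modulate (ζ + ζ') F := by
  ext x
  simp only [modulate_apply, inner_add_right, AddChar.map_add_eq_mul, mul_smul]

theorem ComplexTest.modulate_zero (F : ComplexTest n) : modulate 0 F = F := by
  ext x
  simp only [modulate_apply, inner_zero_right, AddChar.map_zero_eq_one, one_smul]

theorem ComplexTest.conj_modulate (ζ : Rn n) (F : ComplexTest n) :
    ComplexTest.conj (modulate ζ F) = modulate (-ζ) (ComplexTest.conj F) := by
  ext x
  simp [Circle.smul_def, inner_neg_right, AddChar.map_neg_eq_inv]

theorem ComplexTest.toComplex_re (F : ComplexTest n) :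
    toComplex (re F) = (2⁻¹ : ℂ) • (F + ComplexTest.conj F) := by
  ext x
  change ((F x).re : ℂ) = 2⁻¹ * (F x + starRingEnd ℂ (F x))
  rw [Complex.re_eq_add_conj]
  ring

theorem ComplexTest.eq_toComplex_re_add_I_smul (F : ComplexTest n) :
    F = toComplex (re F) - Complex.I • toComplex (re (Complex.I • F)) := by
  ext x
  change F x = ((F x).re : ℂ) - Complex.I * ((Complex.I * F x).re : ℂ)
  apply Complex.ext <;> simp

theorem ComplexTest.fourier_modulate (ζ : Rn n) (F : ComplexTest n) (ξ : Rn n) :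
    𝓕 (modulate ζ F : Rn n → ℂ) ξ = 𝓕 (F : Rn n → ℂ) (ξ - ζ) := by
  simp only [Real.fourier_eq, modulate_apply, smul_smul, ← AddChar.map_add_eq_mul,
    inner_sub_right, neg_sub, neg_add_eq_sub]

theorem ComplexTest.fourierInv_mul_modulate (b : Rn n → ℂ) (ζ : Rn n) (G : ComplexTest n)
    (ξ : Rn n) :
    𝓕⁻ (fun x => b x * modulate ζ G x) ξ = 𝓕⁻ (fun x => b x * G x) (ξ + ζ) := by
  simp only [Real.fourierInv_eq, modulate_apply, mul_smul_comm, smul_smul,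
    ← AddChar.map_add_eq_mul, inner_add_right]

theorem ComplexTest.integrable_one_add_norm_rpow_mul_norm_fourier (F : ComplexTest n) (p : ℝ) :
    Integrable fun ξ => (1 + ‖ξ‖) ^ p * ‖𝓕 (F : Rn n → ℂ) ξ‖ := by
  have h := integrable_one_add_norm_rpow_mul_norm_schwartz volume
    (𝓕 (F.hasCompactSupport.toSchwartzMap F.contDiff)) p
  rwa [SchwartzMap.fourier_coe] at h

theorem ComplexTest.continuous_fourier (F : ComplexTest n) : Continuous (𝓕 (F : Rn n → ℂ)) :=
  VectorFourier.fourierIntegral_continuous Real.continuous_fourierChar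
    continuous_inner F.integrable

theorem ComplexTest.integrable_fourier (F : ComplexTest n) : Integrable (𝓕 (F : Rn n → ℂ)) := by
  refine (integrable_one_add_norm_rpow_mul_norm_fourier F 0).mono
    (continuous_fourier F).aestronglyMeasurable (ae_of_all _ fun ξ => ?_)
  simp

theorem ComplexTest.fourierInv_fourier (F : ComplexTest n) : 𝓕⁻ (𝓕 (F : Rn n → ℂ)) = F :=
  F.contDiff.continuous.fourierInv_fourier_eq F.integrable (integrable_fourier F)

theorem ComplexTest.integral_fourier_mul_fourierInv (F : ComplexTest n) {g : Rn n → ℂ}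
    (hg : Integrable g) :
    ∫ ξ, 𝓕 (F : Rn n → ℂ) ξ * 𝓕⁻ g ξ = ∫ x, F x * g x := by
  have hflip : (-innerₗ (Rn n)).flip = -innerₗ (Rn n) := by
    ext x y
    simp [real_inner_comm]
  have h := VectorFourier.integral_fourierIntegral_smul_eq_flip (μ := volume) (ν := volume)
    (L := -innerₗ (Rn n)) Real.continuous_fourierChar continuous_inner.neg
    (integrable_fourier F) hg
  rw [hflip] at h
  calc ∫ ξ, 𝓕 (F : Rn n → ℂ) ξ * 𝓕⁻ g ξ = ∫ x, 𝓕⁻ (𝓕 (F : Rn n → ℂ)) x * g x := h.symm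
    _ = ∫ x, F x * g x := by rw [fourierInv_fourier]

end TestFunctions

/-! ### Symbols and the pairing of a pseudodifferential operator -/

section Symbols

open ComplexTest RealTest

variable {n : ℕ} {d : ℝ} {b : Rn n → Rn n → ℂ}

/-- The part of the definition of a symbol of order `d` that the argument uses: continuity,
continuous differentiability in `x`, and the estimates of order `d`, without gain for derivatives
in `ξ`, for `b` and `∂_x b`. -/
structure HasSymbolBounds (d : ℝ) (b : Rn n → Rn n → ℂ) : Prop where
  continuous : Continuous fun z : Rn n × Rn n => b z.1 z.2
  contDiff : ∀ ξ, ContDiff ℝ 1 fun x => b x ξ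
  bound : ∃ C : ℝ, 0 ≤ C ∧ ∀ x ξ,
    ‖b x ξ‖ ≤ C * (1 + ‖ξ‖) ^ d ∧ ‖fderiv ℝ (fun x' => b x' ξ) x‖ ≤ C * (1 + ‖ξ‖) ^ d

theorem SymbolEstimates.exists_norm_le {S : Set (Rn n)} (h : SymbolEstimates d S b) :
    ∃ C : ℝ, 0 ≤ C ∧ ∀ x, ∀ ξ ∈ S, ‖b x ξ‖ ≤ C * (1 + ‖ξ‖) ^ d := by
  obtain ⟨C, hC⟩ := h 0 0
  refine ⟨|C|, abs_nonneg C, fun x ξ hξ => ?_⟩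
  calc ‖b x ξ‖ ≤ C * (1 + ‖ξ‖) ^ d := by simpa using hC x ξ hξ
    _ ≤ |C| * (1 + ‖ξ‖) ^ d := by gcongr; exact le_abs_self C

theorem SymbolEstimates.exists_norm_fderiv_le {S : Set (Rn n)} (h : SymbolEstimates d S b) :
    ∃ C : ℝ, 0 ≤ C ∧ ∀ x, ∀ ξ ∈ S, ‖fderiv ℝ (fun x' => b x' ξ) x‖ ≤ C * (1 + ‖ξ‖) ^ d := by
  obtain ⟨C, hC⟩ := h 1 0
  refine ⟨|C|, abs_nonneg C, fun x ξ hξ => ?_⟩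
  have hzero : (fun x' => iteratedFDeriv ℝ 0 (b x') ξ) =
      (continuousMultilinearCurryFin0 ℝ (Rn n) ℂ).symm ∘ fun x' => b x' ξ := rfl
  calc ‖fderiv ℝ (fun x' => b x' ξ) x‖ ≤ C * (1 + ‖ξ‖) ^ d := by
        have := hC x ξ hξ
        rwa [hzero, LinearIsometryEquiv.norm_iteratedFDeriv_comp_left, norm_iteratedFDeriv_one,
          Nat.cast_zero, sub_zero] at this
    _ ≤ |C| * (1 + ‖ξ‖) ^ d := by gcongr; exact le_abs_self C

theorem SymbolEstimates.hasSymbolBounds (h : SymbolEstimates d univ b)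
    (hsmooth : ContDiff ℝ (⊤ : ℕ∞) fun z : Rn n × Rn n => b z.1 z.2) : HasSymbolBounds d b := by
  obtain ⟨C, hC, hb⟩ := h.exists_norm_le
  obtain ⟨C', hC', hb'⟩ := h.exists_norm_fderiv_le
  refine ⟨hsmooth.continuous, fun ξ => ?_, C + C', add_nonneg hC hC', fun x ξ => ⟨?_, ?_⟩⟩
  · exact (hsmooth.comp (contDiff_id.prodMk contDiff_const)).of_le (by exact_mod_cast le_top)
  · exact (hb x ξ (mem_univ ξ)).trans (by gcongr; linarith)
  · exact (hb' x ξ (mem_univ ξ)).trans (by gcongr; linarith)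

theorem HasSymbolBounds.comp_smul (hb : HasSymbolBounds d b) {c : ℝ} (hc : 1 ≤ c) :
    HasSymbolBounds d fun x ξ => b x (c • ξ) := by
  obtain ⟨C, hC, hbound⟩ := hb.bound
  refine ⟨hb.continuous.comp (continuous_fst.prodMk (continuous_snd.const_smul c)),
    fun ξ => hb.contDiff (c • ξ), C * c ^ |d|, by positivity, fun x ξ => ?_⟩
  have hweight : C * (1 + ‖c • ξ‖) ^ d ≤ C * c ^ |d| * (1 + ‖ξ‖) ^ d := by
    rw [mul_assoc]
    gcongr
    exact one_add_norm_smul_rpow_le hc ξ d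
  exact ⟨(hbound x _).1.trans hweight, (hbound x _).2.trans hweight⟩

theorem HasSymbolBounds.comp_add_right (hb : HasSymbolBounds d b) (ζ : Rn n) :
    HasSymbolBounds d fun x ξ => b x (ξ + ζ) := by
  obtain ⟨C, hC, hbound⟩ := hb.bound
  refine ⟨hb.continuous.comp (continuous_fst.prodMk (continuous_snd.add continuous_const)),
    fun ξ => hb.contDiff (ξ + ζ), C * (1 + ‖ζ‖) ^ |d|, by positivity, fun x ξ => ?_⟩
  have hweight : C * (1 + ‖ξ + ζ‖) ^ d ≤ C * (1 + ‖ζ‖) ^ |d| * (1 + ‖ξ‖) ^ d := by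
    rw [mul_assoc]
    gcongr
    exact one_add_norm_add_rpow_le ξ ζ d
  exact ⟨(hbound x _).1.trans hweight, (hbound x _).2.trans hweight⟩

theorem HasSymbolBounds.continuous_left (hb : HasSymbolBounds d b) (ξ : Rn n) :
    Continuous fun x => b x ξ :=
  (hb.contDiff ξ).continuous

theorem HasSymbolBounds.integrable_mul (hb : HasSymbolBounds d b) (G : ComplexTest n) (ξ : Rn n) :
    Integrable fun x => b x ξ * G x :=
  ((hb.continuous_left ξ).mul G.contDiff.continuous).integrable_of_hasCompactSupport
    G.hasCompactSupport.mul_left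

theorem HasSymbolBounds.exists_norm_fourierInv_le (hb : HasSymbolBounds d b)
    (G : ComplexTest n) :
    ∃ C : ℝ, 0 ≤ C ∧ ∀ ξ w,
      ‖𝓕⁻ (fun x => b x ξ * G x) w‖ ≤ C * (1 + ‖ξ‖) ^ d * (1 + ‖w‖)⁻¹ := by
  obtain ⟨C, hC, hbound⟩ := hb.bound
  have hG : ContDiff ℝ 1 G := G.contDiff.of_le (by exact_mod_cast le_top)
  have hG' : Integrable (fderiv ℝ G) :=
    (hG.continuous_fderiv one_ne_zero).integrable_of_hasCompactSupport
      (G.hasCompactSupport.fderiv ℝ)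
  refine ⟨C * (2 * (∫ x, ‖G x‖) + ∫ x, ‖fderiv ℝ G x‖), by positivity, fun ξ w => ?_⟩
  set W := (1 + ‖ξ‖) ^ d
  have hvalue : ∫ x, ‖b x ξ * G x‖ ≤ C * W * ∫ x, ‖G x‖ := by
    rw [← integral_const_mul]
    refine integral_mono (hb.integrable_mul G ξ).norm (G.integrable.norm.const_mul _) fun x => ?_
    simp only [norm_mul]
    gcongr
    exact (hbound x ξ).1
  have hderiv : ∫ x, ‖fderiv ℝ (fun x => b x ξ * G x) x‖ ≤
      C * W * ((∫ x, ‖fderiv ℝ G x‖) + ∫ x, ‖G x‖) := by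
    rw [← integral_add hG'.norm G.integrable.norm, ← integral_const_mul]
    refine integral_mono_of_nonneg (ae_of_all _ fun x => norm_nonneg _)
      ((hG'.norm.add G.integrable.norm).const_mul _) (ae_of_all _ fun x => ?_)
    simp only
    rw [fderiv_fun_mul ((hb.contDiff ξ).differentiable one_ne_zero x)
      (hG.differentiable one_ne_zero x), mul_add]
    refine (norm_add_le _ _).trans ?_
    rw [norm_smul, norm_smul, mul_comm ‖G x‖]
    gcongr
    exacts [(hbound x ξ).1, (hbound x ξ).2]
  rw [← div_eq_mul_inv, le_div_iff₀ (by positivity), mul_comm]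
  calc (1 + ‖w‖) * ‖𝓕⁻ (fun x => b x ξ * G x) w‖
      ≤ C * W * (∫ x, ‖G x‖) + C * W * ((∫ x, ‖fderiv ℝ G x‖) + ∫ x, ‖G x‖) :=
        (one_add_norm_mul_norm_fourierInv_le ((hb.contDiff ξ).mul hG)
          G.hasCompactSupport.mul_left w).trans (add_le_add hvalue hderiv)
    _ = C * (2 * (∫ x, ‖G x‖) + ∫ x, ‖fderiv ℝ G x‖) * W := by ring

theorem HasSymbolBounds.continuous_fourierInv (hb : HasSymbolBounds d b) (G : ComplexTest n) :
    Continuous fun ξ => 𝓕⁻ (fun x => b x ξ * G x) ξ := by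
  simp only [Real.fourierInv_eq]
  rw [← continuousOn_univ]
  refine continuousOn_integral_of_compact_support G.hasCompactSupport ?_ fun ξ x _ hx => ?_
  · have hchar : Continuous fun z : Rn n × Rn n => Real.fourierChar (inner ℝ z.2 z.1) :=
      Real.continuous_fourierChar.comp (continuous_snd.inner continuous_fst)
    exact (hchar.smul ((hb.continuous.comp continuous_swap).mul
      (G.contDiff.continuous.comp continuous_snd))).continuousOn
  · simp [image_eq_zero_of_notMem_tsupport hx]

/-- The bilinear pairing `⟨Op(a) F, G⟩ = ∫ (Op(a) F) G`, written on the Fourier side for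
the rescaled symbol `b(x, ξ) = a(x, 2πξ)`, in agreement with the normalization of `𝓕`. -/
def symbolPairing (b : Rn n → Rn n → ℂ) (F G : ComplexTest n) : ℂ :=
  ∫ ξ, 𝓕 (F : Rn n → ℂ) ξ * 𝓕⁻ (fun x => b x ξ * G x) ξ

theorem symbolPairing_modulate (b : Rn n → Rn n → ℂ) (F G : ComplexTest n) (ζ ζ' : Rn n) :
    symbolPairing b (modulate ζ F) (modulate ζ' G) =
      symbolPairing (fun x ξ => b x (ξ + ζ)) F (modulate (ζ + ζ') G) := by
  rw [symbolPairing, symbolPairing, ← integral_add_right_eq_self _ ζ]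
  refine integral_congr_ae (ae_of_all _ fun ξ => ?_)
  simp only
  rw [fourier_modulate, fourierInv_mul_modulate, fourierInv_mul_modulate, add_sub_cancel_right,
    add_assoc]

theorem HasSymbolBounds.integrable_fourier_mul_fourierInv (hb : HasSymbolBounds d b)
    (F G : ComplexTest n) :
    Integrable fun ξ => 𝓕 (F : Rn n → ℂ) ξ * 𝓕⁻ (fun x => b x ξ * G x) ξ := by
  obtain ⟨C, hC, hbound⟩ := hb.exists_norm_fourierInv_le G
  refine ((integrable_one_add_norm_rpow_mul_norm_fourier F d).const_mul C).mono'
    ((continuous_fourier F).mul (hb.continuous_fourierInv G)).aestronglyMeasurable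
    (ae_of_all _ fun ξ => ?_)
  have hinv : (1 + ‖ξ‖)⁻¹ ≤ 1 := inv_le_one_of_one_le₀ (by linarith [norm_nonneg ξ])
  calc ‖𝓕 (F : Rn n → ℂ) ξ * 𝓕⁻ (fun x => b x ξ * G x) ξ‖
      ≤ ‖𝓕 (F : Rn n → ℂ) ξ‖ * (C * (1 + ‖ξ‖) ^ d * 1) := by
        rw [norm_mul]
        gcongr
        exact (hbound ξ ξ).trans (by gcongr)
    _ = C * ((1 + ‖ξ‖) ^ d * ‖𝓕 (F : Rn n → ℂ) ξ‖) := by ring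

theorem HasSymbolBounds.symbolPairing_add_left (hb : HasSymbolBounds d b)
    (F F' G : ComplexTest n) :
    symbolPairing b (F + F') G = symbolPairing b F G + symbolPairing b F' G := by
  rw [symbolPairing, symbolPairing, symbolPairing, ← integral_add
    (hb.integrable_fourier_mul_fourierInv F G) (hb.integrable_fourier_mul_fourierInv F' G)]
  refine integral_congr_ae (ae_of_all _ fun ξ => ?_)
  have hadd : 𝓕 (F + F' : Rn n → ℂ) ξ = 𝓕 (F : Rn n → ℂ) ξ + 𝓕 (F' : Rn n → ℂ) ξ :=
    congrFun (VectorFourier.fourierIntegral_add Real.continuous_fourierChar continuous_inner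
      F.integrable F'.integrable) ξ
  exact (congrArg (· * _) hadd).trans (add_mul _ _ _)

theorem symbolPairing_smul_left (b : Rn n → Rn n → ℂ) (c : ℂ) (F G : ComplexTest n) :
    symbolPairing b (c • F) G = c * symbolPairing b F G := by
  have hsmul (ξ : Rn n) : 𝓕 (c • (F : Rn n → ℂ)) ξ = c * 𝓕 (F : Rn n → ℂ) ξ :=
    congrFun (VectorFourier.fourierIntegral_const_smul Real.fourierChar volume (innerₗ (Rn n))
      F c) ξ
  rw [symbolPairing, symbolPairing, ← integral_const_mul]
  exact integral_congr_ae (ae_of_all _ fun ξ =>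
    (congrArg (· * _) (hsmul ξ)).trans (mul_assoc _ _ _))

theorem HasSymbolBounds.symbolPairing_add_right (hb : HasSymbolBounds d b)
    (F G G' : ComplexTest n) :
    symbolPairing b F (G + G') = symbolPairing b F G + symbolPairing b F G' := by
  rw [symbolPairing, symbolPairing, symbolPairing, ← integral_add
    (hb.integrable_fourier_mul_fourierInv F G) (hb.integrable_fourier_mul_fourierInv F G')]
  refine integral_congr_ae (ae_of_all _ fun ξ => ?_)
  have hadd : 𝓕⁻ (fun x => b x ξ * (G x + G' x)) ξ =
      𝓕⁻ (fun x => b x ξ * G x) ξ + 𝓕⁻ (fun x => b x ξ * G' x) ξ := by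
    simp only [mul_add]
    exact congrFun (VectorFourier.fourierIntegral_add Real.continuous_fourierChar
      continuous_inner.neg (hb.integrable_mul G ξ) (hb.integrable_mul G' ξ)) ξ
  exact (congrArg (_ * ·) hadd).trans (mul_add _ _ _)

theorem symbolPairing_smul_right (b : Rn n → Rn n → ℂ) (c : ℂ) (F G : ComplexTest n) :
    symbolPairing b F (c • G) = c * symbolPairing b F G := by
  have hsmul (ξ : Rn n) : 𝓕⁻ (fun x => b x ξ * (c * G x)) ξ = c * 𝓕⁻ (fun x => b x ξ * G x) ξ := by
    simp only [mul_left_comm _ c]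
    exact congrFun (VectorFourier.fourierIntegral_const_smul Real.fourierChar volume
      (-innerₗ (Rn n)) (fun x => b x ξ * G x) c) ξ
  rw [symbolPairing, symbolPairing, ← integral_const_mul]
  exact integral_congr_ae (ae_of_all _ fun ξ =>
    (congrArg (_ * ·) (hsmul ξ)).trans (mul_left_comm _ _ _))

theorem HasSymbolBounds.exists_norm_symbolPairing_shift_le (hb : HasSymbolBounds d b)
    (F G : ComplexTest n) :
    ∃ C : ℝ, 0 ≤ C ∧ ∀ ζ w, ‖symbolPairing (fun x ξ => b x (ξ + ζ)) F (modulate w G)‖ ≤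
      C * (1 + ‖ζ‖) ^ d * (1 + ‖w‖)⁻¹ := by
  obtain ⟨C, hC, hbound⟩ := hb.exists_norm_fourierInv_le G
  have hint := integrable_one_add_norm_rpow_mul_norm_fourier F (|d| + 1)
  refine ⟨C * ∫ ξ, (1 + ‖ξ‖) ^ (|d| + 1) * ‖𝓕 (F : Rn n → ℂ) ξ‖, by positivity, fun ζ w => ?_⟩
  have hpeetre (ξ : Rn n) : (1 + ‖ξ + w‖)⁻¹ ≤ (1 + ‖ξ‖) * (1 + ‖w‖)⁻¹ := by
    simpa [Real.rpow_neg_one, add_comm w] using one_add_norm_add_rpow_le w ξ (-1)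
  calc ‖symbolPairing (fun x ξ => b x (ξ + ζ)) F (modulate w G)‖
      ≤ ∫ ξ, C * (1 + ‖ζ‖) ^ d * (1 + ‖w‖)⁻¹ *
          ((1 + ‖ξ‖) ^ (|d| + 1) * ‖𝓕 (F : Rn n → ℂ) ξ‖) := by
        refine norm_integral_le_of_norm_le (hint.const_mul _) (ae_of_all _ fun ξ => ?_)
        rw [norm_mul, fourierInv_mul_modulate]
        calc ‖𝓕 (F : Rn n → ℂ) ξ‖ * ‖𝓕⁻ (fun x => b x (ξ + ζ) * G x) (ξ + w)‖
            ≤ ‖𝓕 (F : Rn n → ℂ) ξ‖ * (C * ((1 + ‖ξ‖) ^ |d| * (1 + ‖ζ‖) ^ d) *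
                ((1 + ‖ξ‖) * (1 + ‖w‖)⁻¹)) := by
              gcongr
              refine (hbound _ _).trans ?_
              gcongr
              exacts [by simpa [add_comm ζ] using one_add_norm_add_rpow_le ζ ξ d, hpeetre ξ]
          _ = _ := by
              rw [Real.rpow_add (by positivity), Real.rpow_one]
              ring
    _ = C * (∫ ξ, (1 + ‖ξ‖) ^ (|d| + 1) * ‖𝓕 (F : Rn n → ℂ) ξ‖) * (1 + ‖ζ‖) ^ d *
          (1 + ‖w‖)⁻¹ := by
        rw [integral_const_mul]
        ring

theorem pseudoDiffOp_eq_integral_fourier (a : Rn n → Rn n → ℂ) (φ : RealTest n) (x : Rn n) :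
    pseudoDiffOp a φ x = ∫ η, Real.fourierChar (inner ℝ x η) •
      (a x ((2 * Real.pi) • η) * 𝓕 (toComplex φ : Rn n → ℂ) η) := by
  have hpi : (0 : ℝ) ≤ (2 * Real.pi) ^ n := by positivity
  set f : Rn n → ℂ := fun ξ => ∫ y, Complex.exp (Complex.I * ((inner ℝ (x - y) ξ : ℝ) : ℂ)) *
    a x ξ * ((φ y : ℝ) : ℂ) with hf
  have hscale := Measure.integral_comp_smul volume f (2 * Real.pi)
  rw [finrank_euclideanSpace_fin, abs_of_nonneg (inv_nonneg.2 hpi), Complex.real_smul,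
    Complex.ofReal_inv] at hscale
  rw [pseudoDiffOp, ← hf, ← hscale]
  refine integral_congr_ae (ae_of_all _ fun η => ?_)
  simp only [hf, Real.fourier_eq, Circle.smul_def, Real.fourierChar_apply, toComplex_apply,
    smul_eq_mul, ← integral_const_mul]
  refine integral_congr_ae (ae_of_all _ fun y => ?_)
  have hexp : Complex.exp (Complex.I * (inner ℝ (x - y) ((2 * Real.pi) • η) : ℝ)) =
      Complex.exp ((2 * Real.pi * inner ℝ x η : ℝ) * Complex.I) *
        Complex.exp ((2 * Real.pi * -inner ℝ y η : ℝ) * Complex.I) := by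
    rw [← Complex.exp_add, inner_smul_right, inner_sub_left]
    push_cast
    ring_nf
  simp only [hexp]
  ring

theorem HasSymbolBounds.integral_pseudoDiffOp_mul {a : Rn n → Rn n → ℂ}
    (ha : HasSymbolBounds d a) (φ ψ : RealTest n) :
    ∫ x, pseudoDiffOp a φ x * (ψ x : ℂ) =
      symbolPairing (fun x ξ => a x ((2 * Real.pi) • ξ)) (toComplex φ) (toComplex ψ) := by
  have hb := ha.comp_smul (c := 2 * Real.pi) (by linarith [Real.pi_gt_three])
  obtain ⟨C, -, hbound⟩ := hb.bound
  set g : Rn n → Rn n → ℂ := fun x η => Real.fourierChar (inner ℝ x η) •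
    (a x ((2 * Real.pi) • η) * 𝓕 (toComplex φ : Rn n → ℂ) η) * toComplex ψ x
  have hg : Integrable (Function.uncurry g) (volume.prod volume) := by
    have hchar : Continuous fun z : Rn n × Rn n => Real.fourierChar (inner ℝ z.1 z.2) :=
      Real.continuous_fourierChar.comp (continuous_fst.inner continuous_snd)
    refine (((toComplex ψ).integrable.norm.mul_prod
      (integrable_one_add_norm_rpow_mul_norm_fourier (toComplex φ) d)).const_mul C).mono'
      (((hchar.smul (hb.continuous.mul ((continuous_fourier _).comp continuous_snd))).mul
        ((toComplex ψ).contDiff.continuous.comp continuous_fst))).aestronglyMeasurable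
      (ae_of_all _ fun z => ?_)
    simp only [Function.uncurry, g, norm_mul, Circle.norm_smul]
    calc ‖a z.1 ((2 * Real.pi) • z.2)‖ * ‖𝓕 (toComplex φ : Rn n → ℂ) z.2‖ * ‖toComplex ψ z.1‖
        ≤ C * (1 + ‖z.2‖) ^ d * ‖𝓕 (toComplex φ : Rn n → ℂ) z.2‖ * ‖toComplex ψ z.1‖ := by
          gcongr
          exact (hbound z.1 z.2).1
      _ = _ := by ring
  calc ∫ x, pseudoDiffOp a φ x * (ψ x : ℂ) = ∫ x, ∫ η, g x η := by
        simp only [pseudoDiffOp_eq_integral_fourier, ← integral_mul_const]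
        rfl
    _ = ∫ η, ∫ x, g x η := integral_integral_swap hg
    _ = symbolPairing (fun x ξ => a x ((2 * Real.pi) • ξ)) (toComplex φ) (toComplex ψ) := by
        refine integral_congr_ae (ae_of_all _ fun η => ?_)
        simp only [Real.fourierInv_eq, ← integral_const_mul, g, Circle.smul_def, smul_eq_mul]
        exact integral_congr_ae (ae_of_all _ fun x => by ring)

end Symbols

/-! ### The high frequency limit -/

section HighFrequency

open ComplexTest RealTest

variable {n : ℕ} {d : ℝ} {b : Rn n → Rn n → ℂ} {η : Rn n}

theorem tendsto_inv_smul_add (ξ η : Rn n) :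
    Tendsto (fun k : ℝ => k⁻¹ • ξ + η) atTop (𝓝 η) := by
  simpa using ((tendsto_inv_atTop_zero (𝕜 := ℝ)).smul_const ξ).add_const η

theorem norm_add_smul_eq_mul (ξ η : Rn n) {k : ℝ} (hk : 0 < k) :
    ‖ξ + k • η‖ = k * ‖k⁻¹ • ξ + η‖ := by
  rw [← norm_smul_of_nonneg hk.le, smul_add, smul_inv_smul₀ hk.ne']

theorem tendsto_norm_add_smul_atTop (ξ : Rn n) (hη : η ≠ 0) :
    Tendsto (fun k : ℝ => ‖ξ + k • η‖) atTop atTop := by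
  refine (tendsto_id.atTop_mul_pos (norm_pos_iff.2 hη)
    (tendsto_inv_smul_add ξ η).norm).congr' ?_
  filter_upwards [eventually_gt_atTop 0] with k hk
  exact (norm_add_smul_eq_mul ξ η hk).symm

theorem tendsto_rpow_neg_mul_norm_add_smul_rpow (d : ℝ) (ξ : Rn n) (hη : η ≠ 0) :
    Tendsto (fun k : ℝ => k ^ (-d) * ‖ξ + k • η‖ ^ d) atTop (𝓝 (‖η‖ ^ d)) := by
  refine ((tendsto_inv_smul_add ξ η).norm.rpow_const (Or.inl (norm_ne_zero_iff.2 hη))).congr' ?_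
  filter_upwards [eventually_gt_atTop 0] with k hk
  rw [norm_add_smul_eq_mul ξ η hk, Real.mul_rpow hk.le (norm_nonneg _), Real.rpow_neg hk.le,
    inv_mul_cancel_left₀ (by positivity)]

theorem tendsto_rpow_neg_mul_one_add_norm_rpow (d : ℝ) (ξ : Rn n) (hη : η ≠ 0) :
    Tendsto (fun k : ℝ => k ^ (-d) * (1 + ‖ξ + k • η‖) ^ d) atTop (𝓝 (‖η‖ ^ d)) := by
  have hlim : Tendsto (fun k : ℝ => k⁻¹ + ‖k⁻¹ • ξ + η‖) atTop (𝓝 ‖η‖) := by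
    simpa using tendsto_inv_atTop_zero.add (tendsto_inv_smul_add ξ η).norm
  refine (hlim.rpow_const (Or.inl (norm_ne_zero_iff.2 hη))).congr' ?_
  filter_upwards [eventually_gt_atTop 0] with k hk
  rw [norm_add_smul_eq_mul ξ η hk, Real.rpow_neg hk.le, ← Real.inv_rpow hk.le,
    ← Real.mul_rpow (by positivity) (by positivity), mul_add, inv_mul_cancel_left₀ hk.ne', mul_one]

theorem exists_eventually_rpow_neg_mul_one_add_norm_rpow_le (d : ℝ) (hη : η ≠ 0) :
    ∃ B : ℝ, 0 ≤ B ∧ ∀ᶠ k : ℝ in atTop, ∀ ξ,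
      k ^ (-d) * (1 + ‖ξ + k • η‖) ^ d ≤ B * (1 + ‖ξ‖) ^ |d| := by
  refine ⟨‖η‖ ^ d + 1, by positivity, ?_⟩
  filter_upwards [(tendsto_rpow_neg_mul_one_add_norm_rpow d 0 hη).eventually_le_const
    (lt_add_one _), eventually_ge_atTop 0] with k hk hk0 ξ
  rw [zero_add] at hk
  calc k ^ (-d) * (1 + ‖ξ + k • η‖) ^ d
      ≤ k ^ (-d) * ((1 + ‖ξ‖) ^ |d| * (1 + ‖k • η‖) ^ d) := by
        gcongr
        rw [add_comm ξ]
        exact one_add_norm_add_rpow_le _ _ d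
    _ = (k ^ (-d) * (1 + ‖k • η‖) ^ d) * (1 + ‖ξ‖) ^ |d| := by ring
    _ ≤ (‖η‖ ^ d + 1) * (1 + ‖ξ‖) ^ |d| := by gcongr

theorem HasPrincipalSymbol.tendsto_rpow_neg_mul {a : Rn n → Rn n → ℂ} {μ : Rn n → ℝ}
    (h : HasPrincipalSymbol d a fun x ξ => ((μ x * ‖ξ‖ ^ d : ℝ) : ℂ)) (hη : η ≠ 0) (x ξ : Rn n) :
    Tendsto (fun k : ℝ => ((k ^ (-d) : ℝ) : ℂ) * a x (ξ + k • η)) atTop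
      (𝓝 ((μ x * ‖η‖ ^ d : ℝ) : ℂ)) := by
  obtain ⟨C, -, hC⟩ := SymbolEstimates.exists_norm_le h
  have hmain : Tendsto (fun k : ℝ => ((μ x * (k ^ (-d) * ‖ξ + k • η‖ ^ d) : ℝ) : ℂ)) atTop
      (𝓝 ((μ x * ‖η‖ ^ d : ℝ) : ℂ)) :=
    (Complex.continuous_ofReal.tendsto _).comp
      ((tendsto_rpow_neg_mul_norm_add_smul_rpow d ξ hη).const_mul _)
  refine hmain.congr_dist ?_
  have hrate : Tendsto (fun k : ℝ => C * (k⁻¹ * (k ^ (-(d - 1)) *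
      (1 + ‖ξ + k • η‖) ^ (d - 1)))) atTop (𝓝 0) := by
    simpa using (tendsto_inv_atTop_zero.mul
      (tendsto_rpow_neg_mul_one_add_norm_rpow (d - 1) ξ hη)).const_mul C
  refine squeeze_zero' (Eventually.of_forall fun _ => dist_nonneg) ?_ hrate
  filter_upwards [eventually_gt_atTop 0,
    (tendsto_norm_add_smul_atTop ξ hη).eventually_ge_atTop 1] with k hk hlarge
  have hfactor : k ^ (-d) = k⁻¹ * k ^ (-(d - 1)) := by
    rw [← Real.rpow_neg_one, ← Real.rpow_add hk]
    ring_nf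
  calc dist ((μ x * (k ^ (-d) * ‖ξ + k • η‖ ^ d) : ℝ) : ℂ) (((k ^ (-d) : ℝ) : ℂ) * a x (ξ + k • η))
      = ‖((k ^ (-d) : ℝ) : ℂ) * (a x (ξ + k • η) - ((μ x * ‖ξ + k • η‖ ^ d : ℝ) : ℂ))‖ := by
        rw [dist_comm, dist_eq_norm]
        push_cast
        ring_nf
    _ ≤ k ^ (-d) * (C * (1 + ‖ξ + k • η‖) ^ (d - 1)) := by
        rw [norm_mul, Complex.norm_real, Real.norm_of_nonneg (by positivity)]
        gcongr
        exact hC x _ hlarge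
    _ = C * (k⁻¹ * (k ^ (-(d - 1)) * (1 + ‖ξ + k • η‖) ^ (d - 1))) := by
        rw [hfactor]
        ring

section Limit

variable {s : Rn n → ℂ} (hb : HasSymbolBounds d b) (hη : η ≠ 0)
  (hlim : ∀ x ξ, Tendsto (fun k : ℝ => ((k ^ (-d) : ℝ) : ℂ) * b x (ξ + k • η)) atTop (𝓝 (s x)))
include hb hη hlim

theorem HasSymbolBounds.tendsto_rpow_neg_mul_fourierInv (G : ComplexTest n) (ξ w : Rn n) :
    Tendsto (fun k : ℝ => ((k ^ (-d) : ℝ) : ℂ) * 𝓕⁻ (fun x => b x (ξ + k • η) * G x) w) atTop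
      (𝓝 (𝓕⁻ (fun x => s x * G x) w)) := by
  obtain ⟨C, hC, hbound⟩ := hb.bound
  obtain ⟨B, -, hB⟩ := exists_eventually_rpow_neg_mul_one_add_norm_rpow_le d hη
  simp only [Real.fourierInv_eq, ← integral_const_mul]
  refine tendsto_integral_filter_of_dominated_convergence
    (fun x => C * (B * (1 + ‖ξ‖) ^ |d|) * ‖G x‖) (Eventually.of_forall fun k => ?_) ?_
    (G.integrable.norm.const_mul _) (ae_of_all _ fun x => ?_)
  · exact (((Real.continuous_fourierChar.comp (continuous_id.inner continuous_const)).smul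
      ((hb.continuous_left _).mul G.contDiff.continuous)).const_mul _).aestronglyMeasurable
  · filter_upwards [hB, eventually_ge_atTop 0] with k hk hk0
    refine ae_of_all _ fun x => ?_
    rw [norm_mul, Circle.norm_smul, norm_mul, Complex.norm_real,
      Real.norm_of_nonneg (by positivity)]
    calc k ^ (-d) * (‖b x (ξ + k • η)‖ * ‖G x‖)
        ≤ k ^ (-d) * (C * (1 + ‖ξ + k • η‖) ^ d * ‖G x‖) := by
          gcongr
          exact (hbound x _).1
      _ = C * (k ^ (-d) * (1 + ‖ξ + k • η‖) ^ d) * ‖G x‖ := by ring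
      _ ≤ C * (B * (1 + ‖ξ‖) ^ |d|) * ‖G x‖ := by
          gcongr C * ?_ * _
          exact hk ξ
  · refine (((hlim x ξ).mul_const (G x)).const_smul (Real.fourierChar (inner ℝ x w))).congr
      fun k => ?_
    rw [mul_assoc, mul_smul_comm]

/-- On the Fourier side the shifted symbol tends, after normalization, to a multiplication by `s`,
and the pairing collapses by Fourier inversion. -/
theorem HasSymbolBounds.tendsto_rpow_neg_mul_symbolPairing (hs : Continuous s)
    (F G : ComplexTest n) :
    Tendsto (fun k : ℝ => ((k ^ (-d) : ℝ) : ℂ) *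
      symbolPairing (fun x ξ => b x (ξ + k • η)) F G) atTop (𝓝 (∫ x, F x * (s x * G x))) := by
  obtain ⟨C, hC, hbound⟩ := hb.exists_norm_fourierInv_le G
  obtain ⟨B, -, hB⟩ := exists_eventually_rpow_neg_mul_one_add_norm_rpow_le d hη
  have hint : Integrable fun x => s x * G x :=
    (hs.mul G.contDiff.continuous).integrable_of_hasCompactSupport G.hasCompactSupport.mul_left
  rw [← integral_fourier_mul_fourierInv F hint]
  simp only [symbolPairing, ← integral_const_mul]
  refine tendsto_integral_filter_of_dominated_convergence
    (fun ξ => C * B * ((1 + ‖ξ‖) ^ |d| * ‖𝓕 (F : Rn n → ℂ) ξ‖)) (Eventually.of_forall fun k => ?_)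
    ?_ ((integrable_one_add_norm_rpow_mul_norm_fourier F |d|).const_mul _)
    (ae_of_all _ fun ξ => ?_)
  · exact (((continuous_fourier F).mul
      ((hb.comp_add_right _).continuous_fourierInv G)).const_mul _).aestronglyMeasurable
  · filter_upwards [hB, eventually_ge_atTop 0] with k hk hk0
    refine ae_of_all _ fun ξ => ?_
    have hinv : (1 + ‖ξ‖)⁻¹ ≤ 1 := inv_le_one_of_one_le₀ (by linarith [norm_nonneg ξ])
    rw [norm_mul, norm_mul, Complex.norm_real, Real.norm_of_nonneg (by positivity)]
    calc k ^ (-d) * (‖𝓕 (F : Rn n → ℂ) ξ‖ * ‖𝓕⁻ (fun x => b x (ξ + k • η) * G x) ξ‖)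
        ≤ k ^ (-d) * (‖𝓕 (F : Rn n → ℂ) ξ‖ * (C * (1 + ‖ξ + k • η‖) ^ d * 1)) := by
          gcongr
          exact (hbound _ ξ).trans (by gcongr)
      _ = C * (k ^ (-d) * (1 + ‖ξ + k • η‖) ^ d) * ‖𝓕 (F : Rn n → ℂ) ξ‖ := by ring
      _ ≤ C * (B * (1 + ‖ξ‖) ^ |d|) * ‖𝓕 (F : Rn n → ℂ) ξ‖ := by
          gcongr C * ?_ * _
          exact hk ξ
      _ = C * B * ((1 + ‖ξ‖) ^ |d| * ‖𝓕 (F : Rn n → ℂ) ξ‖) := by ring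
  · refine ((hb.tendsto_rpow_neg_mul_fourierInv hη hlim G ξ ξ).const_mul
      (𝓕 (F : Rn n → ℂ) ξ)).congr fun k => ?_
    ring

end Limit

end HighFrequency

/-! ### Second moments of a modulated random field -/

section SecondMoments

open ComplexTest RealTest

variable {n : ℕ} {Ω : Type*} [MeasurableSpace Ω] {P : Measure Ω} {q : Ω → RealTest n →ₗ[ℝ] ℝ}
  {a : Rn n → Rn n → ℂ} {d m : ℝ} {μ : Rn n → ℝ} {η : Rn n}

/-- The mean `φ ↦ 𝔼⟨q, φ⟩` of a random field is given by a smooth function. -/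
def HasSmoothMean (P : Measure Ω) (q : Ω → RealTest n →ₗ[ℝ] ℝ) : Prop :=
  ∃ f : Rn n → ℝ, ContDiff ℝ (⊤ : ℕ∞) f ∧ ∀ φ : RealTest n, ∫ ω, q ω φ ∂P = ∫ x, f x * φ x

theorem HasSmoothMean.exists_abs_integral_modulate_le (hmean : HasSmoothMean P q)
    (F : ComplexTest n) (p : ℝ) :
    ∃ C : ℝ, 0 ≤ C ∧ ∀ ζ, |∫ ω, q ω (re (modulate ζ F)) ∂P| ≤ C * (1 + ‖ζ‖) ^ (-p) := by
  obtain ⟨f, hf, hmean⟩ := hmean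
  have hfF : ContDiff ℝ (⊤ : ℕ∞) fun x => (f x : ℂ) * F x :=
    (Complex.ofRealCLM.contDiff.comp hf).mul F.contDiff
  have hsupp : HasCompactSupport fun x => (f x : ℂ) * F x := F.hasCompactSupport.mul_left
  obtain ⟨C, hC, hdecay⟩ :=
    exists_norm_schwartz_le_one_add_norm_rpow (𝓕⁻ (hsupp.toSchwartzMap hfF)) p
  refine ⟨C, hC, fun ζ => ?_⟩
  have hint : Integrable fun x => (f x : ℂ) * modulate ζ F x :=
    ((Complex.continuous_ofReal.comp hf.continuous).mul
      (modulate ζ F).contDiff.continuous).integrable_of_hasCompactSupport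
        (modulate ζ F).hasCompactSupport.mul_left
  have hre : ∫ ω, q ω (re (modulate ζ F)) ∂P = (𝓕⁻ (fun x => (f x : ℂ) * F x) ζ).re := by
    calc ∫ ω, q ω (re (modulate ζ F)) ∂P = ∫ x, ((f x : ℂ) * modulate ζ F x).re := by
          simp [hmean]
      _ = (∫ x, (f x : ℂ) * modulate ζ F x).re := integral_re hint
      _ = (𝓕⁻ (fun x => (f x : ℂ) * F x) ζ).re := by
          simp only [Real.fourierInv_eq, modulate_apply, mul_smul_comm]
  rw [hre]
  refine (Complex.abs_re_le_norm _).trans ?_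
  have hbound := hdecay ζ
  rw [SchwartzMap.fourierInv_coe] at hbound
  exact hbound

theorem HasCovarianceSymbol.covariance_re (hcov : HasCovarianceSymbol P q a)
    (ha : HasSymbolBounds d a) (F G : ComplexTest n) :
    covariance (fun ω => q ω (re F)) (fun ω => q ω (re G)) P =
      2⁻¹ * (symbolPairing (fun x ξ => a x ((2 * Real.pi) • ξ)) F G +
        symbolPairing (fun x ξ => a x ((2 * Real.pi) • ξ)) F (ComplexTest.conj G)).re := by
  have hb := ha.comp_smul (c := 2 * Real.pi) (by linarith [Real.pi_gt_three])
  set S := symbolPairing fun x ξ => a x ((2 * Real.pi) • ξ) with hS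
  have hreal (φ ψ : RealTest n) : S (toComplex φ) (toComplex ψ) =
      (covariance (fun ω => q ω φ) (fun ω => q ω ψ) P : ℝ) := by
    rw [hcov, ha.integral_pseudoDiffOp_mul]
  have hleft : (S F (toComplex (re G))).re =
      covariance (fun ω => q ω (re F)) (fun ω => q ω (re G)) P := by
    conv_lhs => rw [eq_toComplex_re_add_I_smul F, sub_eq_add_neg, ← neg_smul, hS,
      hb.symbolPairing_add_left, symbolPairing_smul_left, ← hS, hreal, hreal]
    simp
  rw [← hleft, toComplex_re, hS, symbolPairing_smul_right, hb.symbolPairing_add_right,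
    ← Complex.ofReal_ofNat, ← Complex.ofReal_inv, Complex.re_ofReal_mul]

theorem HasCovarianceSymbol.covariance_re_modulate (hcov : HasCovarianceSymbol P q a)
    (ha : HasSymbolBounds d a) (F G : ComplexTest n) (ζ ζ' : Rn n) :
    covariance (fun ω => q ω (re (modulate ζ F))) (fun ω => q ω (re (modulate ζ' G))) P =
      2⁻¹ * (symbolPairing (fun x ξ => a x ((2 * Real.pi) • (ξ + ζ))) F (modulate (ζ + ζ') G) +
        symbolPairing (fun x ξ => a x ((2 * Real.pi) • (ξ + ζ))) F
          (modulate (ζ - ζ') (ComplexTest.conj G))).re := by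
  rw [hcov.covariance_re ha, conj_modulate, symbolPairing_modulate, symbolPairing_modulate,
    sub_eq_add_neg]

theorem HasCovarianceSymbol.exists_abs_covariance_modulate_le (hcov : HasCovarianceSymbol P q a)
    (ha : HasSymbolBounds d a) (F G : ComplexTest n) :
    ∃ C : ℝ, 0 ≤ C ∧ ∀ ζ ζ',
      |covariance (fun ω => q ω (re (modulate ζ F))) (fun ω => q ω (re (modulate ζ' G))) P| ≤
        C * (1 + ‖ζ‖) ^ d * ((1 + ‖ζ + ζ'‖)⁻¹ + (1 + ‖ζ - ζ'‖)⁻¹) := by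
  have hb := ha.comp_smul (c := 2 * Real.pi) (by linarith [Real.pi_gt_three])
  obtain ⟨C, hC, hbound⟩ := hb.exists_norm_symbolPairing_shift_le F G
  obtain ⟨C', hC', hbound'⟩ := hb.exists_norm_symbolPairing_shift_le F (ComplexTest.conj G)
  refine ⟨C + C', by positivity, fun ζ ζ' => ?_⟩
  set W := (1 + ‖ζ‖) ^ d
  rw [hcov.covariance_re_modulate ha, abs_mul, abs_of_pos (by norm_num : (0 : ℝ) < 2⁻¹)]
  calc 2⁻¹ * |(symbolPairing _ F (modulate (ζ + ζ') G) +
        symbolPairing _ F (modulate (ζ - ζ') (ComplexTest.conj G))).re|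
      ≤ 1 * (C * W * (1 + ‖ζ + ζ'‖)⁻¹ + C' * W * (1 + ‖ζ - ζ'‖)⁻¹) := by
        gcongr
        · norm_num
        · exact (Complex.abs_re_le_norm _).trans ((norm_add_le _ _).trans
            (add_le_add (hbound ζ _) (hbound' ζ _)))
    _ ≤ 1 * ((C + C') * W * (1 + ‖ζ + ζ'‖)⁻¹ + (C + C') * W * (1 + ‖ζ - ζ'‖)⁻¹) := by
        gcongr <;> linarith
    _ = (C + C') * W * ((1 + ‖ζ + ζ'‖)⁻¹ + (1 + ‖ζ - ζ'‖)⁻¹) := by ring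

theorem IsGaussianGeneralizedRandomFunction.memLp_two
    (hq : IsGaussianGeneralizedRandomFunction P q) (φ : RealTest n) :
    MemLp (fun ω => q ω φ) 2 P :=
  (hq.gaussian.hasGaussianLaw_eval φ).memLp_two

variable [IsProbabilityMeasure P]

theorem IsGaussianGeneralizedRandomFunction.integral_mul_eq
    (hq : IsGaussianGeneralizedRandomFunction P q) (φ ψ : RealTest n) :
    ∫ ω, q ω φ * q ω ψ ∂P = covariance (fun ω => q ω φ) (fun ω => q ω ψ) P +
      (∫ ω, q ω φ ∂P) * ∫ ω, q ω ψ ∂P := by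
  rw [covariance_eq_sub (hq.memLp_two φ) (hq.memLp_two ψ)]
  simp

theorem exists_abs_integral_mul_modulate_le (hq : IsGaussianGeneralizedRandomFunction P q)
    (hmean : HasSmoothMean P q) (hcov : HasCovarianceSymbol P q a) (ha : HasSymbolBounds d a)
    (F G : ComplexTest n) :
    ∃ C : ℝ, 0 ≤ C ∧ ∀ ζ ζ',
      |∫ ω, q ω (re (modulate ζ F)) * q ω (re (modulate ζ' G)) ∂P| ≤
        C * (1 + ‖ζ‖) ^ d * ((1 + ‖ζ + ζ'‖)⁻¹ + (1 + ‖ζ - ζ'‖)⁻¹) := by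
  obtain ⟨C, hC, hbound⟩ := hcov.exists_abs_covariance_modulate_le ha F G
  obtain ⟨A, hA, hmeanF⟩ := hmean.exists_abs_integral_modulate_le F (1 - d)
  obtain ⟨B, hB, hmeanG⟩ := hmean.exists_abs_integral_modulate_le G 1
  refine ⟨C + A * B, by positivity, fun ζ ζ' => ?_⟩
  set W := (1 + ‖ζ‖) ^ d
  have hweight : (1 + ‖ζ‖) ^ (-(1 - d)) * (1 + ‖ζ'‖) ^ (-1 : ℝ) ≤ W * (1 + ‖ζ + ζ'‖)⁻¹ := by
    have htriangle : 1 + ‖ζ + ζ'‖ ≤ (1 + ‖ζ‖) * (1 + ‖ζ'‖) := by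
      linarith [norm_add_le ζ ζ', mul_nonneg (norm_nonneg ζ) (norm_nonneg ζ')]
    rw [neg_sub, Real.rpow_sub_one (by positivity), Real.rpow_neg_one, div_mul_eq_mul_div,
      mul_div_assoc, div_eq_mul_inv, mul_comm _⁻¹, ← mul_inv]
    gcongr
  rw [hq.integral_mul_eq]
  calc |covariance (fun ω => q ω (re (modulate ζ F))) (fun ω => q ω (re (modulate ζ' G))) P +
        (∫ ω, q ω (re (modulate ζ F)) ∂P) * ∫ ω, q ω (re (modulate ζ' G)) ∂P|
      ≤ C * W * ((1 + ‖ζ + ζ'‖)⁻¹ + (1 + ‖ζ - ζ'‖)⁻¹) +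
          (A * (1 + ‖ζ‖) ^ (-(1 - d))) * (B * (1 + ‖ζ'‖) ^ (-1 : ℝ)) := by
        refine (abs_add_le _ _).trans (add_le_add (hbound ζ ζ') ?_)
        rw [abs_mul]
        exact mul_le_mul (hmeanF ζ) (hmeanG ζ') (abs_nonneg _) (by positivity)
    _ ≤ C * W * ((1 + ‖ζ + ζ'‖)⁻¹ + (1 + ‖ζ - ζ'‖)⁻¹) +
          A * B * W * ((1 + ‖ζ + ζ'‖)⁻¹ + (1 + ‖ζ - ζ'‖)⁻¹) := by
        refine add_le_add le_rfl ?_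
        calc A * (1 + ‖ζ‖) ^ (-(1 - d)) * (B * (1 + ‖ζ'‖) ^ (-1 : ℝ))
            = A * B * ((1 + ‖ζ‖) ^ (-(1 - d)) * (1 + ‖ζ'‖) ^ (-1 : ℝ)) := by ring
          _ ≤ A * B * (W * ((1 + ‖ζ + ζ'‖)⁻¹ + (1 + ‖ζ - ζ'‖)⁻¹)) := by
              gcongr A * B * ?_
              refine hweight.trans ?_
              gcongr
              exact le_add_of_nonneg_right (by positivity)
          _ = _ := by ring
    _ = (C + A * B) * W * ((1 + ‖ζ + ζ'‖)⁻¹ + (1 + ‖ζ - ζ'‖)⁻¹) := by ring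

end SecondMoments

section NormalizedWave

open ComplexTest RealTest

variable {n : ℕ} {Ω : Type*} [MeasurableSpace Ω] {P : Measure Ω}
  {q : Ω → RealTest n →ₗ[ℝ] ℝ} {a : Rn n → Rn n → ℂ} {m : ℝ} {μ : Rn n → ℝ} {η : Rn n}

/-- The real part of the pairing of the random field `q` with the wave packet of frequency `k • η`
and amplitude `F`, normalized so that its variance stabilizes as `k → ∞` when the covariance
operator of `q` has order `-m`. -/
def normalizedWave (q : Ω → RealTest n →ₗ[ℝ] ℝ) (m : ℝ) (η : Rn n) (F : ComplexTest n) (k : ℝ)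
    (ω : Ω) : ℝ :=
  k ^ (m / 2) * q ω (re (modulate (k • η) F))

theorem rpow_mul_one_add_norm_smul_rpow_neg_le (hm : 0 ≤ m) (hη : η ≠ 0) {k : ℝ} (hk : 0 ≤ k) :
    k ^ m * (1 + ‖k • η‖) ^ (-m) ≤ ‖η‖ ^ (-m) := by
  have hη' : 0 < ‖η‖ := norm_pos_iff.2 hη
  rw [Real.rpow_neg (by positivity), Real.rpow_neg hη'.le, ← div_eq_mul_inv,
    div_le_iff₀ (by positivity), ← Real.inv_rpow hη'.le, ← Real.mul_rpow (by positivity)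
    (by positivity), norm_smul, Real.norm_of_nonneg hk]
  refine Real.rpow_le_rpow hk ?_ hm
  rw [← div_eq_inv_mul, le_div_iff₀ hη']
  linarith

theorem inv_one_add_norm_smul_le (hη : η ≠ 0) (t : ℝ) :
    (1 + ‖t • η‖)⁻¹ ≤ (1 + ‖η‖⁻¹) / (1 + |t|) := by
  have : 0 < ‖η‖ := norm_pos_iff.2 hη
  rw [le_div_iff₀ (by positivity), inv_mul_le_iff₀ (by positivity), norm_smul, Real.norm_eq_abs]
  have hexpand : (1 + |t| * ‖η‖) * (1 + ‖η‖⁻¹) = 1 + |t| + (|t| * ‖η‖ + ‖η‖⁻¹) := by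
    field_simp
    ring
  rw [hexpand]
  exact le_add_of_nonneg_right (by positivity)

theorem HasSymbolBounds.tendsto_rpow_neg_mul_symbolPairing_modulate {b : Rn n → Rn n → ℂ} {d : ℝ}
    (hb : HasSymbolBounds d b) (hη : η ≠ 0) (F G : ComplexTest n) :
    Tendsto (fun k : ℝ => ((k ^ (-d) : ℝ) : ℂ) * symbolPairing (fun x ξ => b x (ξ + k • η)) F
      (modulate (k • η + k • η) G)) atTop (𝓝 0) := by
  obtain ⟨C, -, hbound⟩ := hb.exists_norm_symbolPairing_shift_le F G
  have hdecay : Tendsto (fun k : ℝ => (1 + ‖k • η + k • η‖)⁻¹) atTop (𝓝 0) := by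
    have hη₂ : η + η ≠ 0 := by rwa [← two_smul ℝ, smul_ne_zero_iff_right two_ne_zero]
    have hnorm := tendsto_norm_add_smul_atTop (0 : Rn n) hη₂
    simp only [zero_add, smul_add] at hnorm
    exact (tendsto_atTop_add_const_left _ 1 hnorm).inv_tendsto_atTop
  have hmajor := ((tendsto_rpow_neg_mul_one_add_norm_rpow d 0 hη).mul hdecay).const_mul C
  rw [mul_zero, mul_zero] at hmajor
  refine squeeze_zero_norm' ?_ hmajor
  filter_upwards [eventually_ge_atTop 0] with k hk
  rw [norm_mul, Complex.norm_real, Real.norm_of_nonneg (by positivity), zero_add]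
  calc k ^ (-d) * ‖symbolPairing (fun x ξ => b x (ξ + k • η)) F (modulate (k • η + k • η) G)‖
      ≤ k ^ (-d) * (C * (1 + ‖k • η‖) ^ d * (1 + ‖k • η + k • η‖)⁻¹) := by
        gcongr
        exact hbound _ _
    _ = C * (k ^ (-d) * (1 + ‖k • η‖) ^ d * (1 + ‖k • η + k • η‖)⁻¹) := by ring

theorem HasSmoothMean.tendsto_rpow_mul_sq_integral (hmean : HasSmoothMean P q) (hη : η ≠ 0)
    (F : ComplexTest n) (m : ℝ) :
    Tendsto (fun k : ℝ => k ^ m * (∫ ω, q ω (re (modulate (k • η) F)) ∂P) ^ 2) atTop (𝓝 0) := by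
  obtain ⟨C, -, hC⟩ := hmean.exists_abs_integral_modulate_le F ((m + 1) / 2)
  have hmajor := (tendsto_inv_atTop_zero.mul
    (tendsto_rpow_neg_mul_one_add_norm_rpow (-(m + 1)) 0 hη)).const_mul (C ^ 2)
  rw [zero_mul, mul_zero] at hmajor
  refine squeeze_zero' ?_ ?_ hmajor <;> filter_upwards [eventually_gt_atTop 0] with k hk
  · positivity
  rw [zero_add]
  calc k ^ m * (∫ ω, q ω (re (modulate (k • η) F)) ∂P) ^ 2
      ≤ k ^ m * (C * (1 + ‖k • η‖) ^ (-((m + 1) / 2))) ^ 2 := by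
        refine mul_le_mul_of_nonneg_left (sq_le_sq.2 ?_) (by positivity)
        exact (hC _).trans (le_abs_self _)
    _ = C ^ 2 * (k⁻¹ * (k ^ (-(-(m + 1))) * (1 + ‖k • η‖) ^ (-(m + 1)))) := by
        rw [mul_pow, ← Real.rpow_mul_natCast (by positivity), Nat.cast_ofNat, neg_mul,
          div_mul_cancel₀ _ two_ne_zero, neg_neg, Real.rpow_add_one hk.ne']
        field_simp

theorem HasCovarianceSymbol.tendsto_rpow_mul_covariance (hcov : HasCovarianceSymbol P q a)
    (ha : HasSymbolBounds (-m) a)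
    (hprincipal : HasPrincipalSymbol (-m) a fun x ξ => ((μ x * ‖ξ‖ ^ (-m) : ℝ) : ℂ))
    (hμ : Continuous μ) (hη : η ≠ 0) (F : ComplexTest n) :
    Tendsto (fun k : ℝ => k ^ m * covariance (fun ω => q ω (re (modulate (k • η) F)))
        (fun ω => q ω (re (modulate (k • η) F))) P) atTop
      (𝓝 (2⁻¹ * (‖(2 * Real.pi) • η‖ ^ (-m) * ∫ x, μ x * ‖F x‖ ^ 2))) := by
  have hb := ha.comp_smul (c := 2 * Real.pi) (by linarith [Real.pi_gt_three])
  have hη' : (2 * Real.pi) • η ≠ 0 := smul_ne_zero (by positivity) hη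
  have hsymbol (x ξ : Rn n) : Tendsto (fun k : ℝ => ((k ^ (-(-m)) : ℝ) : ℂ) *
      a x ((2 * Real.pi) • (ξ + k • η))) atTop
      (𝓝 ((μ x * ‖(2 * Real.pi) • η‖ ^ (-m) : ℝ) : ℂ)) := by
    simpa only [smul_add, smul_comm (2 * Real.pi) _ η] using
      hprincipal.tendsto_rpow_neg_mul hη' x ((2 * Real.pi) • ξ)
  have hsum := (hb.tendsto_rpow_neg_mul_symbolPairing_modulate hη F F).add
    (hb.tendsto_rpow_neg_mul_symbolPairing hη hsymbol
      (Complex.continuous_ofReal.comp (hμ.mul_const _)) F (ComplexTest.conj F))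
  have hlimit : ∫ x, F x * (((μ x * ‖(2 * Real.pi) • η‖ ^ (-m) : ℝ) : ℂ) *
      ComplexTest.conj F x) =
      ((‖(2 * Real.pi) • η‖ ^ (-m) * ∫ x, μ x * ‖F x‖ ^ 2 : ℝ) : ℂ) := by
    rw [← integral_const_mul, ← integral_complex_ofReal]
    refine integral_congr_ae (ae_of_all _ fun x => ?_)
    simp only [conj_apply, mul_left_comm (F x), Complex.mul_conj, Complex.normSq_eq_norm_sq]
    push_cast
    ring
  rw [zero_add, hlimit] at hsum
  refine (((Complex.continuous_re.tendsto _).comp hsum).const_mul 2⁻¹).congr fun k => ?_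
  rw [hcov.covariance_re_modulate ha, sub_self, modulate_zero, mul_left_comm, neg_neg]
  simp only [Function.comp_apply, ← mul_add, Complex.re_ofReal_mul]

variable [IsProbabilityMeasure P]

theorem exists_abs_integral_normalizedWave_mul_le (hq : IsGaussianGeneralizedRandomFunction P q)
    (hmean : HasSmoothMean P q) (hcov : HasCovarianceSymbol P q a) (ha : HasSymbolBounds (-m) a)
    (hm : 0 ≤ m) (hη : η ≠ 0) (F : ComplexTest n) :
    ∃ C : ℝ, ∀ k, 0 ≤ k → ∀ l, 0 ≤ l →
      |∫ ω, normalizedWave q m η F k ω * normalizedWave q m η F l ω ∂P| ≤ C / (1 + |k - l|) := by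
  obtain ⟨C, hC, hbound⟩ := exists_abs_integral_mul_modulate_le hq hmean hcov ha F F
  have hordered {k l : ℝ} (hl : 0 ≤ l) (hlk : l ≤ k) :
      |∫ ω, normalizedWave q m η F k ω * normalizedWave q m η F l ω ∂P| ≤
        C * ‖η‖ ^ (-m) * 2 * (1 + ‖η‖⁻¹) / (1 + |k - l|) := by
    have hk : 0 ≤ k := hl.trans hlk
    have hsum : (1 + ‖k • η + l • η‖)⁻¹ ≤ (1 + ‖k • η - l • η‖)⁻¹ := by
      rw [← add_smul, ← sub_smul, norm_smul, norm_smul, Real.norm_of_nonneg (add_nonneg hk hl),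
        Real.norm_of_nonneg (sub_nonneg.2 hlk)]
      gcongr
      linarith
    set E := ∫ ω, q ω (re (modulate (k • η) F)) * q ω (re (modulate (l • η) F)) ∂P
    have hscale : ∫ ω, normalizedWave q m η F k ω * normalizedWave q m η F l ω ∂P =
        k ^ (m / 2) * l ^ (m / 2) * E := by
      simp only [normalizedWave, mul_mul_mul_comm, integral_const_mul, E]
    calc |∫ ω, normalizedWave q m η F k ω * normalizedWave q m η F l ω ∂P|
        = k ^ (m / 2) * l ^ (m / 2) * |E| := by
          rw [hscale, abs_mul, abs_of_nonneg (by positivity)]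
      _ ≤ k ^ (m / 2) * k ^ (m / 2) *
          (C * (1 + ‖k • η‖) ^ (-m) * (2 * (1 + ‖k • η - l • η‖)⁻¹)) := by
          gcongr
          refine (hbound _ _).trans ?_
          gcongr
          linarith
      _ = C * (k ^ m * (1 + ‖k • η‖) ^ (-m)) * 2 * (1 + ‖(k - l) • η‖)⁻¹ := by
          rw [← Real.rpow_add_of_nonneg hk (by positivity) (by positivity), add_halves, sub_smul]
          ring
      _ ≤ C * ‖η‖ ^ (-m) * 2 * ((1 + ‖η‖⁻¹) / (1 + |k - l|)) := by
          gcongr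
          · exact rpow_mul_one_add_norm_smul_rpow_neg_le hm hη hk
          · exact inv_one_add_norm_smul_le hη _
      _ = C * ‖η‖ ^ (-m) * 2 * (1 + ‖η‖⁻¹) / (1 + |k - l|) := mul_div_assoc' _ _ _
  refine ⟨C * ‖η‖ ^ (-m) * 2 * (1 + ‖η‖⁻¹), fun k hk l hl => ?_⟩
  rcases le_total l k with hlk | hkl
  · exact hordered hl hlk
  · rw [abs_sub_comm]
    simpa only [mul_comm (normalizedWave q m η F l _)] using hordered hk hkl

theorem tendsto_integral_normalizedWave_sq (hq : IsGaussianGeneralizedRandomFunction P q)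
    (hmean : HasSmoothMean P q) (hcov : HasCovarianceSymbol P q a) (ha : HasSymbolBounds (-m) a)
    (hprincipal : HasPrincipalSymbol (-m) a fun x ξ => ((μ x * ‖ξ‖ ^ (-m) : ℝ) : ℂ))
    (hμ : Continuous μ) (hη : η ≠ 0) (F : ComplexTest n) :
    Tendsto (fun k : ℝ => ∫ ω, normalizedWave q m η F k ω ^ 2 ∂P) atTop
      (𝓝 (2⁻¹ * (‖(2 * Real.pi) • η‖ ^ (-m) * ∫ x, μ x * ‖F x‖ ^ 2))) := by
  have hlim := (hcov.tendsto_rpow_mul_covariance ha hprincipal hμ hη F).add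
    (hmean.tendsto_rpow_mul_sq_integral hη F m)
  rw [add_zero] at hlim
  refine hlim.congr' ?_
  filter_upwards [eventually_ge_atTop 0] with k hk
  simp only [normalizedWave, mul_pow, integral_const_mul]
  rw [← Real.rpow_mul_natCast hk, Nat.cast_ofNat, div_mul_cancel₀ m two_ne_zero, ← mul_add]
  simp only [sq, hq.integral_mul_eq]

end NormalizedWave

/-! ### Continuity of the paths -/

section PathContinuity

section Parameter

variable {E F G : Type*} [NormedAddCommGroup E] [NormedSpace ℝ E] [NormedAddCommGroup F]
  [NormedSpace ℝ F] [NormedAddCommGroup G] [NormedSpace ℝ G] {f : E × F → G}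

theorem iteratedFDeriv_comp_prodMk (hf : ContDiff ℝ (⊤ : ℕ∞) f) (i : ℕ) (s : E) (x : F) :
    iteratedFDeriv ℝ i (fun y => f (s, y)) x =
      (iteratedFDeriv ℝ i f (s, x)).compContinuousLinearMap
        fun _ => ContinuousLinearMap.inr ℝ E F := by
  have hcomp : (fun y => f (s, y)) = (fun z => f ((s, 0) + z)) ∘ ContinuousLinearMap.inr ℝ E F := by
    ext y
    simp
  have hshift : ContDiff ℝ (⊤ : ℕ∞) fun z => f ((s, 0) + z) :=
    hf.comp (contDiff_const.add contDiff_id)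
  rw [hcomp, ContinuousLinearMap.iteratedFDeriv_comp_right _ hshift _ (i := i)
    (by exact_mod_cast le_top), iteratedFDeriv_comp_add_left]
  simp

theorem continuous_iteratedFDeriv_comp_prodMk (hf : ContDiff ℝ (⊤ : ℕ∞) f) (i : ℕ) :
    Continuous fun z : E × F => iteratedFDeriv ℝ i (fun y => f (z.1, y)) z.2 := by
  simp only [iteratedFDeriv_comp_prodMk hf]
  exact (ContinuousMultilinearMap.compContinuousLinearMapL (F := G)
    (fun _ : Fin i => ContinuousLinearMap.inr ℝ E F)).continuous.comp
      (hf.continuous_iteratedFDeriv (by exact_mod_cast le_top))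

theorem tendsto_iSup_norm_iteratedFDeriv_of_eq_zero (hf : ContDiff ℝ (⊤ : ℕ∞) f) {K : Set F}
    (hK : IsCompact K) (hsupp : ∀ t, tsupport (fun y => f (t, y)) ⊆ K) {s : E}
    (hs : ∀ y, f (s, y) = 0) (i : ℕ) :
    Tendsto (fun t => ⨆ x, ‖iteratedFDeriv ℝ i (fun y => f (t, y)) x‖) (𝓝 s) (𝓝 0) := by
  have hzero (x : F) : iteratedFDeriv ℝ i (fun y => f (s, y)) x = 0 := by
    simp only [hs, iteratedFDeriv_fun_zero, Pi.zero_apply]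
  rw [Metric.tendsto_nhds]
  intro ε hε
  have hnear : ∀ᶠ t in 𝓝 s, ∀ x ∈ K, ‖iteratedFDeriv ℝ i (fun y => f (t, y)) x‖ < ε / 2 := by
    refine hK.eventually_forall_of_forall_eventually fun x _ => ?_
    have hlim := (continuous_iteratedFDeriv_comp_prodMk hf i).norm.tendsto (s, x)
    refine hlim.eventually_lt_const ?_
    rw [hzero, norm_zero]
    exact half_pos hε
  filter_upwards [hnear] with t ht
  have hsup : ⨆ x, ‖iteratedFDeriv ℝ i (fun y => f (t, y)) x‖ ≤ ε / 2 := by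
    refine Real.iSup_le (fun x => ?_) (half_pos hε).le
    by_cases hx : x ∈ K
    · exact (ht x hx).le
    · rw [image_eq_zero_of_notMem_tsupport
        (notMem_subset ((tsupport_iteratedFDeriv_subset i).trans (hsupp t)) hx), norm_zero]
      exact (half_pos hε).le
  rw [dist_zero_right, Real.norm_of_nonneg (Real.iSup_nonneg fun _ => norm_nonneg _)]
  exact hsup.trans_lt (half_lt_self hε)

end Parameter

open ComplexTest

variable {n : ℕ} {Ω : Type*} [MeasurableSpace Ω] {P : Measure Ω} {q : Ω → RealTest n →ₗ[ℝ] ℝ}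

theorem IsGeneralizedRandomFunction.ae_continuous (hq : IsGeneralizedRandomFunction P q)
    {E : Type*} [NormedAddCommGroup E] [NormedSpace ℝ E] {φ : E → RealTest n}
    (hφ : ContDiff ℝ (⊤ : ℕ∞) fun z : E × Rn n => φ z.1 z.2) {K : Set (Rn n)} (hK : IsCompact K)
    (hsupp : ∀ s, tsupport (φ s) ⊆ K) :
    ∀ᵐ ω ∂P, Continuous fun s => q ω (φ s) := by
  obtain ⟨C, N, -, -, -, hbound⟩ := hq.bound K hK
  filter_upwards [hbound] with ω hω
  refine continuous_iff_continuousAt.2 fun s => ?_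
  have hsub (t : E) : tsupport (φ t - φ s : RealTest n) ⊆ K :=
    (tsupport_sub (φ t) (φ s)).trans (union_subset (hsupp t) (hsupp s))
  have hderiv (i : ℕ) :
      Tendsto (fun t => ⨆ x, ‖iteratedFDeriv ℝ i (φ t - φ s : RealTest n) x‖) (𝓝 s) (𝓝 0) :=
    tendsto_iSup_norm_iteratedFDeriv_of_eq_zero
      (f := fun z : E × Rn n => (φ z.1 - φ s : RealTest n) z.2)
      (hφ.sub ((φ s).contDiff.comp contDiff_snd)) hK hsub (fun _ => sub_self _) i
  have hmajor := (tendsto_finsetSum (Finset.range (N + 1)) fun i _ => hderiv i).const_mul (C ω)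
  rw [Finset.sum_const_zero, mul_zero] at hmajor
  rw [ContinuousAt, tendsto_iff_norm_sub_tendsto_zero]
  refine squeeze_zero (fun _ => norm_nonneg _) (fun t => ?_) hmajor
  rw [← map_sub, Real.norm_eq_abs]
  exact hω _ (hsub t)

theorem IsGeneralizedRandomFunction.ae_continuous_modulate (hq : IsGeneralizedRandomFunction P q)
    (F : ComplexTest n) : ∀ᵐ ω ∂P, Continuous fun ζ => q ω (re (modulate ζ F)) := by
  refine hq.ae_continuous (Complex.reCLM.contDiff.comp
    (contDiff_fourierChar_inner.mul (F.contDiff.comp contDiff_snd))) F.hasCompactSupport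
    fun ζ => closure_mono fun x hx hFx => hx ?_
  rw [re_apply, modulate_apply, hFx, smul_zero, Complex.zero_re]

end PathContinuity

/-! ### Averages of products of wave packet pairings -/

section Averages

open ComplexTest RealTest

theorem mul_conj_eq_sum_norm_sq (z w : ℂ) :
    z * starRingEnd ℂ w =
      4⁻¹ * ∑ j ∈ Finset.range 4, starRingEnd ℂ (Complex.I ^ j) *
        ((‖w + Complex.I ^ j * z‖ ^ 2 : ℝ) : ℂ) := by
  simp only [Finset.sum_range_succ, Finset.sum_range_zero, Complex.ofReal_pow, ← Complex.mul_conj',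
    map_add, map_mul, map_neg, map_one, Complex.conj_I, pow_zero, pow_one, Complex.I_sq,
    Complex.I_pow_three]
  linear_combination
    -2⁻¹ * (w * starRingEnd ℂ z - z * starRingEnd ℂ w) * Complex.I_sq

theorem ofReal_mul_integral_mul_conj_eq_sum {T : Type*} [MeasurableSpace T] {ν : Measure T}
    {w : T → ℝ} {f g : T → ℂ} (c : ℝ)
    (hint : ∀ α : ℂ, Integrable (fun t => w t * ‖g t + α * f t‖ ^ 2) ν) :
    (c : ℂ) * ∫ t, (w t : ℂ) * (f t * starRingEnd ℂ (g t)) ∂ν =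
      4⁻¹ * ∑ j ∈ Finset.range 4, starRingEnd ℂ (Complex.I ^ j) *
        ((c * ∫ t, w t * ‖g t + Complex.I ^ j * f t‖ ^ 2 ∂ν : ℝ) : ℂ) := by
  simp only [← integral_const_mul, ← integral_complex_ofReal]
  rw [← integral_finsetSum _ fun j _ => ((hint _).const_mul c).ofReal.const_mul _,
    ← integral_const_mul]
  refine integral_congr_ae (ae_of_all _ fun t => ?_)
  simp only [mul_conj_eq_sum_norm_sq (f t), Finset.mul_sum]
  refine Finset.sum_congr rfl fun j _ => ?_
  push_cast
  ring

variable {n : ℕ}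

theorem complexPairing_eq (T : RealTest n →ₗ[ℝ] ℝ) (F : ComplexTest n) :
    complexPairing T F = T (re F) - Complex.I * T (re (Complex.I • F)) := by
  have him : TestFunction.postcompCLM Complex.imCLM F = -re (Complex.I • F) := by
    ext x
    change (F x).im = -(Complex.I * F x).re
    simp
  rw [complexPairing, him, map_neg, Complex.ofReal_neg, mul_neg, ← sub_eq_add_neg]
  rfl

theorem complexPairing_add (T : RealTest n →ₗ[ℝ] ℝ) (F G : ComplexTest n) :
    complexPairing T (F + G) = complexPairing T F + complexPairing T G := by
  simp only [complexPairing_eq, smul_add, map_add, Complex.ofReal_add]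
  ring

theorem complexPairing_smul (T : RealTest n →ₗ[ℝ] ℝ) (c : ℂ) (F : ComplexTest n) :
    complexPairing T (c • F) = c * complexPairing T F := by
  have hre (c : ℂ) : re (c • F) = c.re • re F + c.im • re (Complex.I • F) := by
    ext x
    change (c * F x).re = c.re * (F x).re + c.im * (Complex.I * F x).re
    simp [sub_eq_add_neg]
  rw [complexPairing_eq, complexPairing_eq, smul_smul, hre c, hre (Complex.I * c)]
  simp only [map_add, map_smul, smul_eq_mul]
  apply Complex.ext <;> simp

theorem norm_complexPairing_sq (T : RealTest n →ₗ[ℝ] ℝ) (F : ComplexTest n) :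
    ‖complexPairing T F‖ ^ 2 = T (re F) ^ 2 + T (re (Complex.I • F)) ^ 2 := by
  rw [complexPairing_eq, ← Complex.normSq_eq_norm_sq, Complex.normSq_apply]
  simp only [Complex.sub_re, Complex.ofReal_re, Complex.mul_re, Complex.I_re, zero_mul,
    Complex.I_im, Complex.ofReal_im, mul_zero, sub_self, sub_zero, Complex.sub_im, Complex.mul_im,
    one_mul, zero_add, zero_sub, mul_neg, neg_mul, neg_neg]
  ring

theorem normalizedWave_sq_add_normalizedWave_I_smul_sq {Ω : Type*}
    (q : Ω → RealTest n →ₗ[ℝ] ℝ) (m : ℝ) (η : Rn n) (F : ComplexTest n) {k : ℝ} (hk : 0 ≤ k)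
    (ω : Ω) :
    normalizedWave q m η F k ω ^ 2 + normalizedWave q m η (Complex.I • F) k ω ^ 2 =
      k ^ m * ‖complexPairing (q ω) (modulate (k • η) F)‖ ^ 2 := by
  simp only [normalizedWave, mul_pow, ← mul_add, norm_complexPairing_sq, map_smul]
  rw [← Real.rpow_mul_natCast hk, Nat.cast_ofNat, div_mul_cancel₀ m two_ne_zero]

variable {Ω : Type*} [MeasurableSpace Ω] {P : Measure Ω}
  {q : Ω → RealTest n →ₗ[ℝ] ℝ} {a : Rn n → Rn n → ℂ} {m : ℝ} {μ : Rn n → ℝ} {η : Rn n}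

theorem IsGeneralizedRandomFunction.ae_continuous_complexPairing_modulate
    (hq : IsGeneralizedRandomFunction P q) (F : ComplexTest n) :
    ∀ᵐ ω ∂P, Continuous fun ζ => complexPairing (q ω) (modulate ζ F) := by
  filter_upwards [hq.ae_continuous_modulate F, hq.ae_continuous_modulate (Complex.I • F)]
    with ω hre him
  simp only [complexPairing_eq, ← map_smul]
  exact (Complex.continuous_ofReal.comp hre).sub
    (continuous_const.mul (Complex.continuous_ofReal.comp him))

theorem IsGeneralizedRandomFunction.ae_continuous_normalizedWave
    (hq : IsGeneralizedRandomFunction P q) (hm : 0 ≤ m) (η : Rn n) (F : ComplexTest n) :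
    ∀ᵐ ω ∂P, Continuous fun k => normalizedWave q m η F k ω := by
  filter_upwards [hq.ae_continuous_modulate F] with ω hω
  exact (Real.continuous_rpow_const (by positivity)).mul
    (hω.comp (continuous_id.smul continuous_const))

theorem IsGaussianGeneralizedRandomFunction.isGaussianProcess_normalizedWave
    (hq : IsGaussianGeneralizedRandomFunction P q) (m : ℝ) (η : Rn n) (F : ComplexTest n) :
    IsGaussianProcess (normalizedWave q m η F) P := by
  have heq : normalizedWave q m η F =
      fun k ω => q ω (k ^ (m / 2) • re (modulate (k • η) F)) := by
    ext k ω
    rw [map_smul, smul_eq_mul, normalizedWave]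
  rw [heq]
  exact hq.gaussian.comp_right _

variable [IsProbabilityMeasure P] (hq : IsGaussianGeneralizedRandomFunction P q)
  (hmean : HasSmoothMean P q) (hm : 0 ≤ m) (hμ : Continuous μ) (ha : HasSymbolBounds (-m) a)
  (hprincipal : HasPrincipalSymbol (-m) a fun x ξ => ((μ x * ‖ξ‖ ^ (-m) : ℝ) : ℂ))
  (hcov : HasCovarianceSymbol P q a) (hη : η ≠ 0)
include hq hmean hm hμ ha hprincipal hcov hη

theorem ae_tendsto_average_normalizedWave_sq (F : ComplexTest n) :
    ∀ᵐ ω ∂P, Tendsto (fun K => K⁻¹ * ∫ k in K..(2 * K), normalizedWave q m η F k ω ^ 2) atTop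
      (𝓝 (2⁻¹ * (‖(2 * Real.pi) • η‖ ^ (-m) * ∫ x, μ x * ‖F x‖ ^ 2))) := by
  obtain ⟨C, hC⟩ := exists_abs_integral_normalizedWave_mul_le hq hmean hcov ha hm hη F
  refine ae_tendsto_average_sq_of_isGaussianProcess (hq.isGaussianProcess_normalizedWave m η F)
    (fun k => (hq.measurable_apply _).const_mul _) (hq.ae_continuous_normalizedWave hm η F) hC
    (tendsto_integral_normalizedWave_sq hq hmean hcov ha hprincipal hμ hη F)

theorem ae_tendsto_average_norm_sq_complexPairing (F : ComplexTest n) :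
    ∀ᵐ ω ∂P, Tendsto (fun K => K⁻¹ *
        ∫ k in K..(2 * K), k ^ m * ‖complexPairing (q ω) (modulate (k • η) F)‖ ^ 2) atTop
      (𝓝 (‖(2 * Real.pi) • η‖ ^ (-m) * ∫ x, μ x * ‖F x‖ ^ 2)) := by
  have haverage (F : ComplexTest n) :=
    ae_tendsto_average_normalizedWave_sq hq hmean hm hμ ha hprincipal hcov hη F
  filter_upwards [haverage F, haverage (Complex.I • F), hq.ae_continuous_normalizedWave hm η F,
    hq.ae_continuous_normalizedWave hm η (Complex.I • F)] with ω hre him hcre hcim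
  have hnorm (x : Rn n) : ‖(Complex.I • F) x‖ = ‖F x‖ := by
    change ‖Complex.I * F x‖ = _
    simp
  have hlim := hre.add him
  simp only [hnorm, ← mul_add, ← two_mul, mul_inv_cancel_left₀ (two_ne_zero (α := ℝ))] at hlim
  refine hlim.congr' ?_
  filter_upwards [eventually_ge_atTop 0] with K hK
  have hint {V : ℝ → ℝ} (hV : Continuous V) :
      IntervalIntegrable (fun k => V k ^ 2) volume K (2 * K) :=
    (hV.pow 2).intervalIntegrable _ _
  rw [← intervalIntegral.integral_add (hint hcre) (hint hcim)]
  refine congrArg _ (intervalIntegral.integral_congr fun k hk => ?_)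
  rw [uIcc_of_le (by linarith)] at hk
  exact normalizedWave_sq_add_normalizedWave_I_smul_sq q m η F (hK.trans hk.1) ω

theorem ae_tendsto_average_complexPairing_mul_conj (F G : ComplexTest n) :
    ∀ᵐ ω ∂P, Tendsto (fun K : ℝ => ((K⁻¹ : ℝ) : ℂ) * ∫ k in K..(2 * K), ((k ^ m : ℝ) : ℂ) *
        (complexPairing (q ω) (modulate (k • η) F) *
          starRingEnd ℂ (complexPairing (q ω) (modulate (k • η) G)))) atTop
      (𝓝 (((‖(2 * Real.pi) • η‖ ^ (-m) : ℝ) : ℂ) *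
        ∫ x, (μ x : ℂ) * (F x * starRingEnd ℂ (G x)))) := by
  have haverage (j : ℕ) := ae_tendsto_average_norm_sq_complexPairing hq hmean hm hμ ha hprincipal
    hcov hη (G + Complex.I ^ j • F)
  filter_upwards [ae_all_iff.2 haverage, hq.ae_continuous_complexPairing_modulate F,
    hq.ae_continuous_complexPairing_modulate G] with ω hω hF hG
  have hcont (α : ℂ) : Continuous fun k : ℝ => k ^ m *
      ‖complexPairing (q ω) (modulate (k • η) G) +
        α * complexPairing (q ω) (modulate (k • η) F)‖ ^ 2 := by
    have hline : Continuous fun k : ℝ => k • η := continuous_id.smul continuous_const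
    exact (Real.continuous_rpow_const hm).mul
      (((hG.comp hline).add (continuous_const.mul (hF.comp hline))).norm.pow 2)
  have hint (α : ℂ) : Integrable fun x => μ x * ‖G x + α * F x‖ ^ 2 := by
    have hsupp : HasCompactSupport fun x => ‖(G + α • F : ComplexTest n) x‖ ^ 2 :=
      (G + α • F).hasCompactSupport.norm.comp_left (g := (· ^ 2)) (by norm_num)
    exact (hμ.mul ((G + α • F).contDiff.continuous.norm.pow 2)).integrable_of_hasCompactSupport
      hsupp.mul_left
  have happly (j : ℕ) (x : Rn n) :
      (G + Complex.I ^ j • F : ComplexTest n) x = G x + Complex.I ^ j * F x := rfl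
  simp only [map_add, map_smul, complexPairing_add, complexPairing_smul, happly] at hω
  rw [ofReal_mul_integral_mul_conj_eq_sum _ hint]
  refine Tendsto.congr' ?_ ((tendsto_finsetSum (Finset.range 4) fun j _ =>
    ((Complex.continuous_ofReal.tendsto _).comp (hω j)).const_mul
      (starRingEnd ℂ (Complex.I ^ j))).const_mul 4⁻¹)
  filter_upwards [eventually_ge_atTop 0] with K hK
  simp only [Function.comp_apply,
    intervalIntegral.integral_of_le (by linarith : K ≤ 2 * K)]
  exact (ofReal_mul_integral_mul_conj_eq_sum _ fun α => (hcont α).integrableOn_Ioc).symm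

end Averages

/-! ### Backscattering -/

section Backscattering

open ComplexTest RealTest

variable {n : ℕ}

theorem planeWave_neg_neg_mul_planeWave (k : ℝ) (θ y : Rn n) :
    planeWave k (-(-θ)) y * planeWave k θ y =
      Real.fourierChar (inner ℝ y (k • Real.pi⁻¹ • θ)) := by
  rw [neg_neg, planeWave, ← Complex.exp_add, Real.fourierChar_apply, real_inner_smul_right,
    real_inner_smul_right, real_inner_comm]
  congr 1
  push_cast
  field_simp
  ring

theorem singleScatteringFarField_neg (c : ℂ) (V : RealTest n →ₗ[ℝ] ℝ) (χ : RealTest n)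
    (k : ℝ) (θ : Rn n) :
    singleScatteringFarField c V χ k θ (-θ) =
      c * complexPairing V (modulate (k • Real.pi⁻¹ • θ) (toComplex χ)) := by
  rw [singleScatteringFarField]
  congr 2
  ext y
  change χ y • (planeWave k (-(-θ)) y * planeWave k θ y) = _
  rw [planeWave_neg_neg_mul_planeWave, modulate_apply, toComplex_apply, Circle.smul_def,
    Complex.real_smul, smul_eq_mul, mul_comm]

theorem backscatteringCorrelation_eq (c : ℂ) (V : RealTest n →ₗ[ℝ] ℝ) (χ : RealTest n)
    (m τ : ℝ) (θ : Rn n) (k : ℝ) :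
    backscatteringCorrelation c V χ m τ θ k = ((‖c‖ ^ 2 : ℝ) : ℂ) * (((k ^ m : ℝ) : ℂ) *
      (complexPairing V (modulate (k • Real.pi⁻¹ • θ) (toComplex χ)) *
        starRingEnd ℂ (complexPairing V (modulate (k • Real.pi⁻¹ • θ)
          (modulate (τ • Real.pi⁻¹ • θ) (toComplex χ)))))) := by
  rw [backscatteringCorrelation, singleScatteringFarField_neg, singleScatteringFarField_neg,
    modulate_modulate, ← add_smul, map_mul, Complex.ofReal_pow, ← Complex.mul_conj']
  ring

theorem backscatteringConst_mul_unitaryFourier (c : ℂ) (m τ : ℝ) (μ : Rn n → ℝ)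
    (χ : RealTest n) {θ : Rn n} (hθ : ‖θ‖ = 1) :
    (backscatteringConst c n m : ℂ) * unitaryFourier (fun x => χ x ^ 2 * μ x) ((2 * τ) • θ) =
      ((‖c‖ ^ 2 : ℝ) : ℂ) * (((‖(2 * Real.pi) • Real.pi⁻¹ • θ‖ ^ (-m) : ℝ) : ℂ) *
        ∫ x, (μ x : ℂ) * (toComplex χ x *
          starRingEnd ℂ (modulate (τ • Real.pi⁻¹ • θ) (toComplex χ) x))) := by
  have hnorm : ‖(2 * Real.pi) • Real.pi⁻¹ • θ‖ = 2 := by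
    rw [smul_smul, mul_inv_cancel_right₀ Real.pi_ne_zero, norm_smul, hθ]
    norm_num
  have hconst : backscatteringConst c n m * (2 * Real.pi) ^ (-((n : ℝ) / 2)) =
      ‖c‖ ^ 2 * 2 ^ (-m) := by
    rw [backscatteringConst, mul_assoc, ← Real.rpow_add (by positivity), add_neg_cancel,
      Real.rpow_zero, mul_one]
  rw [unitaryFourier, ← mul_assoc, ← Complex.ofReal_mul, hconst, hnorm, ← mul_assoc,
    ← Complex.ofReal_mul]
  congr 2 with x
  rw [modulate_apply, toComplex_apply, Circle.smul_def, Real.fourierChar_apply, smul_eq_mul,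
    map_mul, Complex.conj_ofReal, ← Complex.exp_conj, real_inner_smul_left, real_inner_comm]
  have hexp : starRingEnd ℂ (((2 * Real.pi * inner ℝ x (τ • Real.pi⁻¹ • θ) : ℝ) : ℂ) * Complex.I) =
      -(Complex.I * ((2 * τ * inner ℝ x θ : ℝ) : ℂ)) := by
    rw [real_inner_smul_right, real_inner_smul_right, map_mul, Complex.conj_ofReal, Complex.conj_I]
    push_cast
    field_simp
  rw [hexp]
  push_cast
  ring

variable {Ω : Type*} [MeasurableSpace Ω] {P : Measure Ω}
  {q : Ω → RealTest n →ₗ[ℝ] ℝ}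

theorem IsGeneralizedRandomFunction.ae_continuous_backscatteringCorrelation {m : ℝ}
    (hq : IsGeneralizedRandomFunction P q) (hm : 0 ≤ m) (c : ℂ) (χ : RealTest n) (τ : ℝ)
    (θ : Rn n) :
    ∀ᵐ ω ∂P, Continuous (backscatteringCorrelation c (q ω) χ m τ θ) := by
  filter_upwards [hq.ae_continuous_complexPairing_modulate (toComplex χ)] with ω hω
  have hline (s : ℝ) : Continuous fun k : ℝ =>
      complexPairing (q ω) (modulate ((k + s) • Real.pi⁻¹ • θ) (toComplex χ)) :=
    hω.comp ((continuous_id.add continuous_const).smul continuous_const)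
  have hzero := hline 0
  simp only [add_zero] at hzero
  unfold backscatteringCorrelation
  simp only [singleScatteringFarField_neg]
  exact ((Complex.continuous_ofReal.comp (Real.continuous_rpow_const hm)).mul
    (continuous_const.mul hzero)).mul
      (Complex.continuous_conj.comp (continuous_const.mul (hline τ)))

theorem sq_mul_eq_of_eqOn_tsupport {X : Type*} [TopologicalSpace X] {f g : X → ℝ}
    (hg : EqOn g 1 (tsupport f)) : (fun x => g x ^ 2 * f x) = f := by
  ext x
  by_cases hx : x ∈ tsupport f
  · simp [hg hx]
  · simp [image_eq_zero_of_notMem_tsupport hx]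

theorem IsMicrolocallyIsotropic.order_nonneg {D : Set (Rn n)} {m : ℝ} {μ : Rn n → ℝ}
    (h : IsMicrolocallyIsotropic P q D m μ) (hn : 1 ≤ n) : 0 ≤ m := by
  have hn' : (1 : ℝ) ≤ n := by exact_mod_cast hn
  linarith [h.lt_order]

end Backscattering

end

theorem mainTheorem3_general {n : ℕ} {Ω : Type*} [MeasurableSpace Ω] (P : Measure Ω)
    [IsProbabilityMeasure P] (m : ℝ) (hm : 0 ≤ m) (μ : Rn n → ℝ) (hμ : Continuous μ)
    (q : Ω → RealTest n →ₗ[ℝ] ℝ) (hq : IsGaussianGeneralizedRandomFunction P q)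
    (hmean : HasSmoothMean P q) (a : Rn n → Rn n → ℂ) (ha : HasSymbolBounds (-m) a)
    (hprincipal : HasPrincipalSymbol (-m) a fun x ξ => ((μ x * ‖ξ‖ ^ (-m) : ℝ) : ℂ))
    (hcov : HasCovarianceSymbol P q a) (c : ℂ) (χ : RealTest n) (τ : ℝ) (θ : Rn n)
    (hθ : ‖θ‖ = 1) :
    ∀ᵐ ω ∂P,
      (∀ K : ℝ,
        IntervalIntegrable (backscatteringCorrelation c (q ω) χ m τ θ) volume K (2 * K)) ∧
      Tendsto
        (fun K : ℝ => ((1 / K : ℝ) : ℂ) *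
          ∫ k in K..(2 * K), backscatteringCorrelation c (q ω) χ m τ θ k)
        atTop
        (𝓝 ((backscatteringConst c n m : ℂ) *
          unitaryFourier (fun x => χ x ^ 2 * μ x) ((2 * τ) • θ))) := by
  have hη : Real.pi⁻¹ • θ ≠ 0 :=
    smul_ne_zero (inv_ne_zero Real.pi_ne_zero) (norm_ne_zero_iff.1 (by simp [hθ]))
  filter_upwards [hq.ae_continuous_backscatteringCorrelation hm c χ τ θ,
    ae_tendsto_average_complexPairing_mul_conj hq hmean hm hμ ha hprincipal hcov hη
      (RealTest.toComplex χ)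
      (ComplexTest.modulate (τ • Real.pi⁻¹ • θ) (RealTest.toComplex χ))] with ω hcont hlim
  refine ⟨fun K => hcont.intervalIntegrable _ _, ?_⟩
  rw [backscatteringConst_mul_unitaryFourier c m τ μ χ hθ]
  refine (hlim.const_mul ((‖c‖ ^ 2 : ℝ) : ℂ)).congr fun K => ?_
  simp only [backscatteringCorrelation_eq, intervalIntegral.integral_const_mul, one_div]
  ring

theorem mainTheorem3 {n : ℕ} (hn : 2 ≤ n)
    {Ω : Type*} [MeasurableSpace Ω] (P : Measure Ω) [IsProbabilityMeasure P]
    (D : Set (Rn n)) (hD_open : IsOpen D) (hD_bounded : Bornology.IsBounded D)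
    (m : ℝ) (μ : Rn n → ℝ) (q : Ω → RealTest n →ₗ[ℝ] ℝ)
    (hq : IsGaussianGeneralizedRandomFunction P q)
    (hq_iso : IsMicrolocallyIsotropic P q D m μ)
    (c : ℂ) (χ : RealTest n) (hχ : ∀ x ∈ D, χ x = 1)
    (τ : ℝ) (hτ : 0 ≤ τ) (θ : Rn n) (hθ : ‖θ‖ = 1) :
    ∀ᵐ ω ∂P,
      (∀ K : ℝ, 0 < K →
        IntervalIntegrable (backscatteringCorrelation c (q ω) χ m τ θ) volume K (2 * K)) ∧
      Tendsto
        (fun K : ℝ => ((1 / K : ℝ) : ℂ) *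
          ∫ k in K..(2 * K), backscatteringCorrelation c (q ω) χ m τ θ k)
        atTop
        (𝓝 ((backscatteringConst c n m : ℂ) * unitaryFourier μ ((2 * τ) • θ))) := by
  obtain ⟨a, ha, hprincipal, hcov⟩ := hq_iso.covariance_symbol
  have hgeneral := mainTheorem3_general P m (hq_iso.order_nonneg (one_le_two.trans hn)) μ
    hq_iso.strength_smooth.continuous q hq hq_iso.mean_smooth a
    (ha.estimates.hasSymbolBounds ha.smooth) hprincipal hcov c χ τ θ hθ
  rw [sq_mul_eq_of_eqOn_tsupport fun x hx => hχ x (hq_iso.strength_support hx)] at hgeneral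
  exact hgeneral.mono fun ω hω => ⟨fun K _ => hω.1 K, hω.2⟩
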